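/- Let $T=(V,E)$ be a tree with $n\ge 2$ vertices and maximum degree at most $k$, and let $L=\{l_1,\dots,l_n\}$ be a set of labels. The true labeling is a bijection $M_T:L\to V$, the hypothesized labeling is an arbitrary map $M_H:L\to V$, and $D(\mathcal T,\mathcal H)=\sum_{l\in L} d_T(M_T(l),M_H(l))$, where $d_T$ is the tree distance. Both labelings start from arbitrary configurations and evolve as follows. In every time unit the tracking algorithm makes one step. It processes the labels cyclically in the order $l_1,\dots,l_n,l_1,\dots$; if $l$ is the current label and $M_H(l)\ne M_T(l)$, it moves $M_H(l)$ to the next vertex on the path in $T$ from $M_H(l)$ to $M_T(l)$; if $M_H(l)=M_T(l)$, it spends the step on noticing this, and the next label becomes the current one. One pass over all $n$ labels is an iteration; iterations are numbered $1,2,\dots$, and $D(\mathcal T,\mathcal H)_j$ denotes the value of $D(\mathcal T,\mathcal H)$ at the start of the $j$-th iteration. At the end of every second time unit (speedup factor $c=2$) the uniformly random evolver picks an edge of $T$ uniformly at random, independently of its earlier choices, and swaps the true locations of the two labels at the endpoints of this edge. Then for every $k$ there are constants $C,\gamma>0$ and a function $z(n)=O(\log n)$, all depending only on $k$, such that for every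 such $T$ with $n$ vertices, every pair of initial labelings, and every $j>z(n)$, $$\Pr\bigl[\,\text{the $j$-th iteration starts, and } D(\mathcal T,\mathcal H)_j\le C\,n\,\bigr]\ \ge\ 1-e^{-\gamma n}.$$ -/

import Mathlib

open MeasureTheory ProbabilityTheory Filter Asymptotics
open scoped ENNReal

namespace LabelTracking

variable {V : Type*} [DecidableEq V] {T : SimpleGraph V} {n : ℕ}

/-- The unique path from `u` to `w` in the tree `T`. -/
noncomputable def treePath (hT : T.IsTree) (u w : V) : T.Walk u w :=
  (hT.existsUnique_path u w).choose

/-- The oracle for the true labeling `M`: on the query `(l, u)` it answers `none` (null) if the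
label `l` resides at `u`, and otherwise the edge `(u, v)`, oriented away from `u`, with which the
path from `u` to the true location of `l` begins. -/
noncomputable def oracle (hT : T.IsTree) (M : Fin n ≃ V) (l : Fin n) (u : V) : Option T.Dart :=
  if h : u = M l then none
  else some ((treePath hT u (M l)).firstDart (SimpleGraph.Walk.not_nil_of_ne h))

/-- A configuration of the whole system: the true (bijective) labeling, the hypothesized (not
necessarily injective) labeling, and the number of labels that the algorithm has finished
processing so far, counted with repetition over all its iterations. -/
structure State (V : Type*) (n : ℕ) where
  truth : Fin n ≃ V
  hyp : Fin n → V
  finished : ℕ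

/-- The label which the algorithm is processing: the labels are processed cyclically in order. -/
def State.current [NeZero n] (s : State V n) : Fin n := Fin.ofNat n s.finished

/-- The number (starting from 1) of the current iteration, that is, of the current pass over all
the labels. -/
def State.iteration (s : State V n) : ℕ := s.finished / n + 1

/-- The overall distance: the sum over all labels of the tree distance between the true and the
hypothesized location. -/
noncomputable def State.distance (T : SimpleGraph V) (s : State V n) : ℕ :=
  ∑ l, T.dist (s.truth l) (s.hyp l)

/-- One step of the tracking algorithm: query the oracle on the current label and its hypothesized
location; on a null answer go on to the next label, otherwise move the label along the edge. -/
noncomputable def algorithmStep [NeZero n] (hT : T.IsTree) (s : State V n) : State V n :=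
  match oracle hT s.truth s.current (s.hyp s.current) with
  | none => { s with finished := s.finished + 1 }
  | some d => { s with hyp := Function.update s.hyp s.current d.snd }

/-- One step of the evolver: the labels at the two endpoints of the edge `e` are swapped. -/
def evolverStep (e : T.edgeSet) (s : State V n) : State V n :=
  { s with truth := s.truth.trans (Sym2.lift ⟨fun u v => Equiv.swap u v, Equiv.swap_comm⟩ e.1) }

/-- The state at time `t`, with initial labelings `M₀` and `H₀` and speedup factor `c`, if the
evolver chooses the edges `e 0, e 1, …`. The algorithm makes one step in every time unit, and the
evolver makes one swap at the end of every `c`-th time unit. -/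
noncomputable def run [NeZero n] (hT : T.IsTree) (c : ℕ) (M₀ : Fin n ≃ V) (H₀ : Fin n → V)
    (e : ℕ → T.edgeSet) : ℕ → State V n
  | 0 => ⟨M₀, H₀, 0⟩
  | t + 1 =>
    if c ∣ t + 1 then evolverStep (e (t / c)) (algorithmStep hT (run hT c M₀ H₀ e t))
    else algorithmStep hT (run hT c M₀ H₀ e t)

/-- In the trajectory `s`, iteration `j` starts at time `t`. -/
def StartsIteration (s : ℕ → State V n) (j t : ℕ) : Prop :=
  IsLeast {t' | (s t').iteration = j} t

/-- A uniformly random evolver: the chosen edges `E 0, E 1, …` are independent random variables,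
each of them uniformly distributed on the edges of the tree `T`. -/
structure IsUniformEvolver {Ω : Type*} [MeasurableSpace Ω] (μ : Measure Ω)
    (E : ℕ → Ω → T.edgeSet) : Prop where
  measurable : ∀ i e, MeasurableSet {ω | E i ω = e}
  indep : iIndepFun (m := fun _ => ⊤) E μ
  uniform : ∀ i e, μ {ω | E i ω = e} = (Nat.card T.edgeSet : ℝ≥0∞)⁻¹

end LabelTracking

/-!
Between two swaps the algorithm makes at least two steps, each of which shortens the distance by one
or finishes a label, while a swap lengthens the distance by at most two. Over an iteration the
distance therefore grows by `O(n)` at most, and the shortfall of the swaps from their maximal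
effect, their *gain*, is pure profit. If an edge is chosen twice, no edge meeting it being chosen in
between, and the algorithm does not touch the labels at its ends meanwhile, then the second swap
undoes the first and the two gain four in total. Among `Θ(n)` successive random choices there are
linearly many such repetitions, except with probability `exp (-Ω(n))`.

During an iteration every label is at its true place at some time, and from then on only the evolver
displaces it. The distance `D'` at the end of an iteration is thus at most twice the number of its
swaps, hence `O(1)` times their gain, so that `D' * (1 + 1 / L) ≤ D + O(n)` for a constant `L`.
As `D ≤ n²` always, `O(log n)` iterations bring the distance down to `O(n)`.
-/

namespace LabelTracking

section Sampling

variable {α Ω : Type*} [MeasurableSpace α] [MeasurableSpace Ω] {μ : Measure Ω} {E : ℕ → Ω → α}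

/-- The random variables `E 0, E 1, …` are independent and uniformly distributed on the finite
type `α`. -/
structure IsIIDUniform [Fintype α] (μ : Measure Ω) (E : ℕ → Ω → α) : Prop where
  measurable : ∀ i, Measurable (E i)
  indep : iIndepFun E μ
  uniform : ∀ i x, μ.real {ω | E i ω = x} = (Fintype.card α : ℝ)⁻¹

section DependsOn

variable [Finite α] [DiscreteMeasurableSpace α] {β γ : Type*} [Nonempty β] [Nonempty γ]

lemma measurable_comp_of_dependsOn [MeasurableSpace β] (hE : ∀ i, Measurable (E i))
    {G : (ℕ → α) → β} {S : Finset ℕ} (hG : DependsOn G S) :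
    Measurable fun ω => G fun i => E i ω := by
  obtain ⟨g, rfl⟩ := dependsOn_iff_exists_comp.1 hG
  exact (Measurable.of_discrete (f := g)).comp (measurable_pi_lambda _ fun i => hE i)

lemma integrable_comp_of_dependsOn [IsFiniteMeasure μ] (hE : ∀ i, Measurable (E i))
    {G : (ℕ → α) → ℝ} {S : Finset ℕ} (hG : DependsOn G S) :
    Integrable (fun ω => G fun i => E i ω) μ := by
  obtain ⟨g, rfl⟩ := dependsOn_iff_exists_comp.1 hG
  exact (Integrable.of_finite (f := g)).comp_measurable (measurable_pi_lambda _ fun i => hE i)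

lemma indepFun_comp_of_dependsOn [MeasurableSpace β] [MeasurableSpace γ]
    (hE : ∀ i, Measurable (E i)) (hind : iIndepFun E μ) {G : (ℕ → α) → β} {G' : (ℕ → α) → γ}
    {S S' : Finset ℕ} (hS : Disjoint S S') (hG : DependsOn G S) (hG' : DependsOn G' S') :
    IndepFun (fun ω => G fun i => E i ω) (fun ω => G' fun i => E i ω) μ := by
  obtain ⟨g, rfl⟩ := dependsOn_iff_exists_comp.1 hG
  obtain ⟨g', rfl⟩ := dependsOn_iff_exists_comp.1 hG'
  exact (hind.indepFun_finset S S' hS hE).comp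
    (Measurable.of_discrete (f := g)) (Measurable.of_discrete (f := g'))

lemma indepSet_of_dependsOn [IsZeroOrProbabilityMeasure μ] (hE : ∀ i, Measurable (E i))
    (hind : iIndepFun E μ) {P P' : (ℕ → α) → Prop} {S S' : Finset ℕ} (hS : Disjoint S S')
    (hP : DependsOn P S) (hP' : DependsOn P' S') :
    IndepSet {ω | P fun i => E i ω} {ω | P' fun i => E i ω} μ := by
  refine (indepSet_iff_measure_inter_eq_mul
    (measurableSet_setOfPred.2 (measurable_comp_of_dependsOn hE hP))
    (measurableSet_setOfPred.2 (measurable_comp_of_dependsOn hE hP')) μ).2 ?_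
  simpa using (indepFun_comp_of_dependsOn hE hind hS hP hP').measure_inter_preimage_eq_mul
    {True} {True} trivial trivial

end DependsOn

namespace IsIIDUniform

variable [Fintype α] [DecidableEq α] [DiscreteMeasurableSpace α] [IsFiniteMeasure μ]

lemma integral_mul_ite_eq (hE : IsIIDUniform μ E) {i : ℕ} {S : Finset ℕ} (hi : i ∉ S)
    {g : (ℕ → α) → ℝ} (hg : DependsOn g S) (x : α) :
    ∫ ω, g (E · ω) * (if E i ω = x then 1 else 0) ∂μ =
      ∫ ω, g (E · ω) * (Fintype.card α : ℝ)⁻¹ ∂μ := by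
  have hx : DependsOn (fun f : ℕ → α => if f i = x then (1 : ℝ) else 0) ({i} : Finset ℕ) := by
    intro f f' hff'
    simp [hff' i]
  have hprob : ∫ ω, (if E i ω = x then (1 : ℝ) else 0) ∂μ = (Fintype.card α : ℝ)⁻¹ := by
    rw [← hE.uniform i x, ← integral_indicator_one
      (measurableSet_eq_fun (hE.measurable i) measurable_const)]
    simp [Set.indicator_apply]
  rw [(indepFun_comp_of_dependsOn hE.measurable hE.indep (by simpa using hi) hg
    hx).integral_fun_mul_eq_mul_integral
      (integrable_comp_of_dependsOn hE.measurable hg).aestronglyMeasurable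
      (integrable_comp_of_dependsOn hE.measurable hx).aestronglyMeasurable,
    integral_mul_const, hprob]

lemma integral_mul_ite_mem (hE : IsIIDUniform μ E) {i : ℕ} {S : Finset ℕ} (hi : i ∉ S)
    {g : (ℕ → α) → ℝ} {A : (ℕ → α) → Finset α} (hg : DependsOn g S) (hA : DependsOn A S) :
    ∫ ω, g (E · ω) * (if E i ω ∈ A (E · ω) then 1 else 0) ∂μ =
      ∫ ω, g (E · ω) * ((A (E · ω)).card / Fintype.card α) ∂μ := by
  have hgA (x : α) : DependsOn (fun f => g f * if x ∈ A f then 1 else 0) S := by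
    intro f f' hff'
    simp only [hg hff', hA hff']
  have hint (x : α) : Integrable (fun ω => (g (E · ω) * if x ∈ A (E · ω) then 1 else 0) *
      if E i ω = x then 1 else 0) μ := by
    refine integrable_comp_of_dependsOn hE.measurable (S := insert i S)
      (G := fun f => (g f * if x ∈ A f then 1 else 0) * if f i = x then 1 else 0) ?_
    intro f f' hff'
    simp only [hff' i (by simp), hgA x fun y hy => hff' y (by simp_all)]
  calc ∫ ω, g (E · ω) * (if E i ω ∈ A (E · ω) then 1 else 0) ∂μ
      = ∫ ω, ∑ x, (g (E · ω) * if x ∈ A (E · ω) then 1 else 0) *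
          (if E i ω = x then 1 else 0) ∂μ := by simp
    _ = ∑ x, ∫ ω, (g (E · ω) * if x ∈ A (E · ω) then 1 else 0) *
          (Fintype.card α : ℝ)⁻¹ ∂μ := by
        rw [integral_finsetSum _ fun x _ => hint x]
        exact Finset.sum_congr rfl fun x _ => hE.integral_mul_ite_eq hi (hgA x) x
    _ = ∫ ω, g (E · ω) * ((A (E · ω)).card / Fintype.card α) ∂μ := by
        rw [← integral_finsetSum _ fun x _ =>
          (integrable_comp_of_dependsOn hE.measurable (hgA x)).mul_const _]
        simp_rw [← Finset.sum_mul, ← Finset.mul_sum, mul_assoc, Finset.sum_boole,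
          Finset.filter_univ_mem, div_eq_mul_inv]

end IsIIDUniform

end Sampling

section HitTimes

variable {α : Type*} [DecidableEq α]

/-- The indices in `[b, b + j)` at which `f` hits the current target: `A i f` is the set of targets
at the index `i`, which may depend on earlier values of `f`. -/
def hitTimes (A : ℕ → (ℕ → α) → Finset α) (b j : ℕ) (f : ℕ → α) : Finset ℕ :=
  {i ∈ Finset.Ico b (b + j) | f i ∈ A i f}

variable {A : ℕ → (ℕ → α) → Finset α} {b j : ℕ} {t p : ℝ}

lemma mem_hitTimes {f : ℕ → α} {i : ℕ} :
    i ∈ hitTimes A b j f ↔ (b ≤ i ∧ i < b + j) ∧ f i ∈ A i f := by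
  simp [hitTimes]

lemma hitTimes_subset {b' j' : ℕ} (hb : b ≤ b') (hj : b' + j' ≤ b + j) (f : ℕ → α) :
    hitTimes A b' j' f ⊆ hitTimes A b j f :=
  Finset.filter_subset_filter _ (Finset.Ico_subset_Ico hb hj)

lemma card_hitTimes_succ (f : ℕ → α) :
    (hitTimes A b (j + 1) f).card =
      (hitTimes A b j f).card + if f (b + j) ∈ A (b + j) f then 1 else 0 := by
  rw [hitTimes, ← add_assoc, ← Finset.insert_Ico_right_eq_Ico_add_one (by omega),
    Finset.filter_insert, hitTimes]
  split_ifs <;> simp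

lemma dependsOn_hitTimes (hA : ∀ i, DependsOn (A i) (Finset.range i)) (b j : ℕ) :
    DependsOn (hitTimes A b j) (Finset.range (b + j)) := by
  intro f g hfg
  refine Finset.filter_congr fun i hi => ?_
  have hij : i < b + j := (Finset.mem_Ico.1 hi).2
  rw [hfg i (Finset.mem_range.2 hij), hA i fun x hx => hfg x (Finset.range_mono hij.le hx)]

variable {Ω : Type*} [MeasurableSpace Ω] {μ : Measure Ω} [IsProbabilityMeasure μ]
  [Fintype α] [MeasurableSpace α] [DiscreteMeasurableSpace α] {E : ℕ → Ω → α}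

namespace IsIIDUniform

lemma integrable_exp_mul_card_hitTimes_mul (hE : IsIIDUniform μ E)
    (hA : ∀ i, DependsOn (A i) (Finset.range i)) (b j : ℕ) (t : ℝ) {S : Finset ℕ}
    {φ : (ℕ → α) → ℝ} (hφ : DependsOn φ S) :
    Integrable (fun ω => Real.exp (t * (hitTimes A b j (E · ω)).card) * φ (E · ω)) μ :=
  integrable_comp_of_dependsOn hE.measurable (S := Finset.range (b + j) ∪ S)
    (G := fun f => Real.exp (t * (hitTimes A b j f).card) * φ f) fun f g hfg => by
      simp only [Finset.coe_union, Set.mem_union] at hfg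
      simp only [dependsOn_hitTimes hA b j fun i hi => hfg i (.inl hi),
        hφ fun i hi => hfg i (.inr hi)]

lemma integrable_exp_mul_card_hitTimes (hE : IsIIDUniform μ E)
    (hA : ∀ i, DependsOn (A i) (Finset.range i)) (b j : ℕ) (t : ℝ) :
    Integrable (fun ω => Real.exp (t * (hitTimes A b j (E · ω)).card)) μ := by
  simpa using hE.integrable_exp_mul_card_hitTimes_mul hA b j t
    ((dependsOn_const (1 : ℝ)).mono (Set.empty_subset (Finset.range 0 : Set ℕ)))

lemma mgf_card_hitTimes_succ (hE : IsIIDUniform μ E)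
    (hA : ∀ i, DependsOn (A i) (Finset.range i)) (b j : ℕ) (t : ℝ) :
    mgf (fun ω => ((hitTimes A b (j + 1) (E · ω)).card : ℝ)) μ t =
      ∫ ω, Real.exp (t * (hitTimes A b j (E · ω)).card) *
        (1 + (Real.exp t - 1) * ((A (b + j) (E · ω)).card / Fintype.card α)) ∂μ := by
  set g : (ℕ → α) → ℝ := fun f => Real.exp (t * (hitTimes A b j f).card)
  have hg : DependsOn g (Finset.range (b + j)) := fun f f' hff' => by
    simp only [g, dependsOn_hitTimes hA b j hff']
  have hsucc (f : ℕ → α) : Real.exp (t * (hitTimes A b (j + 1) f).card) =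
      g f + (Real.exp t - 1) * (g f * if f (b + j) ∈ A (b + j) f then 1 else 0) := by
    rw [card_hitTimes_succ, Nat.cast_add, mul_add, Real.exp_add]
    split_ifs <;> simp [g]; ring
  have hmem : DependsOn (fun f => if f (b + j) ∈ A (b + j) f then (1 : ℝ) else 0)
      (Finset.range (b + j + 1)) := fun f f' hff' => by
    simp only [hff' (b + j) (by simp),
      hA (b + j) fun i hi => hff' i (Finset.range_subset_range.2 (b + j).le_succ hi)]
  have hcard : DependsOn (fun f => ((A (b + j) f).card : ℝ) / Fintype.card α)
      (Finset.range (b + j)) := fun f f' hff' => by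
    simp only [hA _ hff']
  have hint := hE.integrable_exp_mul_card_hitTimes hA b j t
  calc mgf (fun ω => ((hitTimes A b (j + 1) (E · ω)).card : ℝ)) μ t
      = ∫ ω, (g (E · ω) + (Real.exp t - 1) *
          (g (E · ω) * if E (b + j) ω ∈ A (b + j) (E · ω) then 1 else 0)) ∂μ :=
        integral_congr_ae (.of_forall fun ω => hsucc (E · ω))
    _ = ∫ ω, g (E · ω) ∂μ + (Real.exp t - 1) *
          ∫ ω, g (E · ω) * ((A (b + j) (E · ω)).card / Fintype.card α) ∂μ := by
        rw [integral_add hint ((hE.integrable_exp_mul_card_hitTimes_mul hA b j t hmem).const_mul _),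
          integral_const_mul, hE.integral_mul_ite_mem (by simp) hg (hA _)]
    _ = _ := by
        rw [← integral_const_mul, ← integral_add hint]
        · exact integral_congr_ae (.of_forall fun ω => by ring)
        · exact (hE.integrable_exp_mul_card_hitTimes_mul hA b j t hcard).const_mul _

/-- An adapted process whose targets cover a fraction of `p` of `α` is compared with the binomial
distribution. For `t < 0` the assumption bounds the size of the targets from below. -/
lemma mgf_card_hitTimes_le (hE : IsIIDUniform μ E)
    (hA : ∀ i, DependsOn (A i) (Finset.range i)) (b j : ℕ)
    (hp : ∀ i < b + j, ∀ f,
      (Real.exp t - 1) * (A i f).card ≤ (Real.exp t - 1) * (p * Fintype.card α)) :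
    mgf (fun ω => ((hitTimes A b j (E · ω)).card : ℝ)) μ t ≤
      Real.exp ((Real.exp t - 1) * p * j) := by
  have : Nonempty α := (nonempty_of_isProbabilityMeasure μ).map (E 0)
  have hfactor {i : ℕ} (hi : i < b + j) (f : ℕ → α) :
      1 + (Real.exp t - 1) * ((A i f).card / Fintype.card α) ≤
        Real.exp ((Real.exp t - 1) * p) := by
    refine le_trans ?_ (Real.add_one_le_exp _)
    rw [add_comm, mul_div_assoc', add_le_add_iff_right, div_le_iff₀ (by positivity), mul_assoc]
    exact hp i hi f
  induction j with
  | zero => simp [hitTimes, mgf]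
  | succ j ih =>
    specialize ih (fun i hi => hp i (by omega)) fun hi => hfactor (by omega)
    calc mgf (fun ω => ((hitTimes A b (j + 1) (E · ω)).card : ℝ)) μ t
        = _ := hE.mgf_card_hitTimes_succ hA b j t
      _ ≤ ∫ ω, Real.exp (t * (hitTimes A b j (E · ω)).card) *
            Real.exp ((Real.exp t - 1) * p) ∂μ := by
          refine integral_mono ?_
            ((hE.integrable_exp_mul_card_hitTimes hA b j t).mul_const _) fun ω => ?_
          · refine hE.integrable_exp_mul_card_hitTimes_mul hA b j t (S := Finset.range (b + j))
              (φ := fun f => 1 + (Real.exp t - 1) * ((A (b + j) f).card / Fintype.card α))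
              fun f f' hff' => ?_
            simp only [hA _ hff']
          · exact mul_le_mul_of_nonneg_left (hfactor (by omega) _) (Real.exp_nonneg _)
      _ ≤ Real.exp ((Real.exp t - 1) * p * j) * Real.exp ((Real.exp t - 1) * p) := by
          rw [integral_mul_const]
          gcongr
          exact ih
      _ = Real.exp ((Real.exp t - 1) * p * (j + 1 : ℕ)) := by
          rw [← Real.exp_add]
          push_cast
          ring_nf

lemma measureReal_le_card_hitTimes_le (hE : IsIIDUniform μ E)
    (hA : ∀ i, DependsOn (A i) (Finset.range i)) (b j : ℕ) (hp0 : 0 ≤ p)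
    (hp : ∀ i < b + j, ∀ f, (A i f).card ≤ p * Fintype.card α) (r : ℝ) :
    μ.real {ω | r ≤ (hitTimes A b j (E · ω)).card} ≤ Real.exp (2 * p * j - r) := by
  have he : 1 ≤ Real.exp 1 := Real.one_le_exp zero_le_one
  have he' : Real.exp 1 - 1 ≤ 2 := by linarith [Real.exp_one_lt_three]
  calc μ.real {ω | r ≤ (hitTimes A b j (E · ω)).card}
      ≤ Real.exp (-1 * r) * mgf (fun ω => ((hitTimes A b j (E · ω)).card : ℝ)) μ 1 :=
        measure_ge_le_exp_mul_mgf r zero_le_one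
          (hE.integrable_exp_mul_card_hitTimes hA b j 1)
    _ ≤ Real.exp (-1 * r) * Real.exp ((Real.exp 1 - 1) * p * j) := by
        gcongr
        exact hE.mgf_card_hitTimes_le hA b j fun i hi f =>
          mul_le_mul_of_nonneg_left (hp i hi f) (sub_nonneg.2 he)
    _ ≤ Real.exp (-1 * r) * Real.exp (2 * p * j) := by gcongr
    _ = Real.exp (2 * p * j - r) := by rw [← Real.exp_add]; ring_nf

lemma measureReal_card_hitTimes_le_le (hE : IsIIDUniform μ E)
    (hA : ∀ i, DependsOn (A i) (Finset.range i)) (b j : ℕ) (hp0 : 0 ≤ p) (hp : p ≤ 1) (r : ℝ) :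
    μ.real {ω | (∀ i ∈ Finset.Ico b (b + j), p * Fintype.card α ≤ (A i (E · ω)).card) ∧
      (hitTimes A b j (E · ω)).card ≤ r} ≤ Real.exp (r - p * j / 2) := by
  set A' : ℕ → (ℕ → α) → Finset α := fun i f =>
    if p * Fintype.card α ≤ (A i f).card then A i f else Finset.univ with hA'def
  have hA' (i : ℕ) : DependsOn (A' i) (Finset.range i) := fun f g hfg => by
    simp only [hA'def, hA i hfg]
  have hpA' (i : ℕ) (f : ℕ → α) : p * Fintype.card α ≤ (A' i f).card := by
    simp only [hA'def]
    split_ifs with h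
    · exact h
    · exact mul_le_of_le_one_left (by positivity) hp
  have hsub : {ω | (∀ i ∈ Finset.Ico b (b + j), p * Fintype.card α ≤ (A i (E · ω)).card) ∧
      (hitTimes A b j (E · ω)).card ≤ r} ⊆ {ω | ((hitTimes A' b j (E · ω)).card : ℝ) ≤ r} := by
    rintro ω ⟨hbig, hr⟩
    have : hitTimes A' b j (E · ω) = hitTimes A b j (E · ω) :=
      Finset.filter_congr fun i hi => by simp only [hA'def, if_pos (hbig i hi)]
    simpa only [Set.mem_ofPred_eq, this] using hr
  have he : Real.exp (-1) - 1 ≤ -(1 / 2) := by linarith [Real.exp_neg_one_lt_half]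
  calc _ ≤ μ.real {ω | ((hitTimes A' b j (E · ω)).card : ℝ) ≤ r} := measureReal_mono hsub
    _ ≤ Real.exp (-(-1) * r) * mgf (fun ω => ((hitTimes A' b j (E · ω)).card : ℝ)) μ (-1) :=
        measure_le_le_exp_mul_mgf r (by norm_num)
          (hE.integrable_exp_mul_card_hitTimes hA' b j (-1))
    _ ≤ Real.exp (-(-1) * r) * Real.exp ((Real.exp (-1) - 1) * p * j) := by
        gcongr
        exact hE.mgf_card_hitTimes_le hA' b j fun i _ f =>
          mul_le_mul_of_nonpos_left (hpA' i f) (by linarith)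
    _ ≤ Real.exp (-(-1) * r) * Real.exp (-(1 / 2) * p * j) := by gcongr
    _ = Real.exp (r - p * j / 2) := by rw [← Real.exp_add]; ring_nf

end IsIIDUniform

end HitTimes

section Repetitions

variable {α : Type*} [DecidableEq α] (R : α → α → Prop) [DecidableRel R]

/-- The values taken by `f` in `[a, a + m)` and before `i` that are unrelated to all values taken
after their last occurrence there. For reflexive `R` these are the values of the first phase
`[a, a + m)` a repetition of which at `i` would be undisturbed. -/
def live (a m : ℕ) (f : ℕ → α) (i : ℕ) : Finset α :=
  {x ∈ Finset.Ico a (min i (a + m)) | ∀ y ∈ Finset.Ioo x i, ¬R (f x) (f y)}.image f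

/-- The values related to a live value. Choosing one of them is what makes live values die. -/
def clashing [Fintype α] (a m i : ℕ) (f : ℕ → α) : Finset α :=
  {x | ∃ y ∈ live R a m f i, R y x}

/-- The indices `i` of the second phase `[a + m, a + 2 * m)` at which `f` repeats a value from the
first phase `[a, a + m)`, no related value having been taken in between. -/
def repeatTimes (a m : ℕ) (f : ℕ → α) : Finset ℕ :=
  hitTimes (fun i f => live R a m f i) (a + m) m f

variable {R} {a m i w : ℕ} {f : ℕ → α}

lemma mem_live {x : α} :
    x ∈ live R a m f i ↔
      ∃ u, a ≤ u ∧ u < i ∧ u < a + m ∧ f u = x ∧ ∀ v, u < v → v < i → ¬R x (f v) := by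
  simp only [live, Finset.mem_image, Finset.mem_filter, Finset.mem_Ico, Finset.mem_Ioo, lt_min_iff]
  grind

lemma live_self (a m : ℕ) (f : ℕ → α) : live R a m f a = ∅ := by simp [live]

lemma live_succ_of_lt (h : a ≤ i) (hi : i < a + m) :
    live R a m f (i + 1) = insert (f i) {x ∈ live R a m f i | ¬R x (f i)} := by
  ext x
  simp only [mem_live, Finset.mem_insert, Finset.mem_filter]
  constructor
  · rintro ⟨u, hau, hui, hum, rfl, hv⟩
    rcases Nat.lt_succ_iff_lt_or_eq.1 hui with hui | rfl
    · exact .inr ⟨⟨u, hau, hui, hum, rfl, fun v hv' hvi => hv v hv' (by omega)⟩,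
        hv i hui (by omega)⟩
    · exact .inl rfl
  · rintro (rfl | ⟨⟨u, hau, hui, hum, rfl, hv⟩, hR⟩)
    · exact ⟨i, h, by omega, hi, rfl, fun v hv => by omega⟩
    · refine ⟨u, hau, by omega, hum, rfl, fun v hv' hvi => ?_⟩
      rcases Nat.lt_succ_iff_lt_or_eq.1 hvi with hvi | rfl
      exacts [hv v hv' hvi, hR]

lemma live_succ_of_le (hi : a + m ≤ i) :
    live R a m f (i + 1) = {x ∈ live R a m f i | ¬R x (f i)} := by
  ext x
  simp only [mem_live, Finset.mem_filter]
  constructor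
  · rintro ⟨u, hau, -, hum, rfl, hv⟩
    exact ⟨⟨u, hau, by omega, hum, rfl, fun v hv' hvi => hv v hv' (by omega)⟩,
      hv i (by omega) (by omega)⟩
  · rintro ⟨⟨u, hau, hui, hum, rfl, hv⟩, hR⟩
    refine ⟨u, hau, by omega, hum, rfl, fun v hv' hvi => ?_⟩
    rcases Nat.lt_succ_iff_lt_or_eq.1 hvi with hvi | rfl
    exacts [hv v hv' hvi, hR]

lemma dependsOn_live (a m i : ℕ) : DependsOn (fun f => live R a m f i) (Finset.Ico a i) := by
  intro f g hfg
  have hfg' (u : ℕ) (hau : a ≤ u) (hui : u < i) : f u = g u :=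
    hfg u (Finset.mem_Ico.2 ⟨hau, hui⟩)
  ext x
  simp only [mem_live]
  grind

lemma mem_repeatTimes :
    i ∈ repeatTimes R a m f ↔ a + m ≤ i ∧ i < a + 2 * m ∧
      ∃ u, a ≤ u ∧ u < a + m ∧ f u = f i ∧ ∀ v, u < v → v < i → ¬R (f i) (f v) := by
  simp only [repeatTimes, mem_hitTimes, mem_live, two_mul, ← add_assoc]
  grind

lemma dependsOn_repeatTimes (a m : ℕ) :
    DependsOn (repeatTimes R a m) (Finset.Ico a (a + 2 * m)) := by
  intro f g hfg
  have hfg' (u : ℕ) (hau : a ≤ u) (hui : u < a + 2 * m) : f u = g u :=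
    hfg u (Finset.mem_Ico.2 ⟨hau, hui⟩)
  ext i
  simp only [mem_repeatTimes]
  grind

lemma card_live_le (a m : ℕ) (f : ℕ → α) (i : ℕ) : (live R a m f i).card ≤ m := by
  refine Finset.card_image_le.trans ((Finset.card_filter_le _ _).trans ?_)
  rw [Nat.card_Ico]
  omega

variable [Fintype α] {κ : ℕ}

lemma card_clashing_le (hdeg : ∀ x, (Finset.univ.filter (R x)).card ≤ κ) (a m i : ℕ) (f : ℕ → α) :
    (clashing R a m i f).card ≤ m * κ :=
  calc (clashing R a m i f).card
      ≤ ((live R a m f i).biUnion fun x => Finset.univ.filter (R x)).card :=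
        Finset.card_le_card fun x hx => by simpa [clashing] using hx
    _ ≤ (live R a m f i).card * κ := Finset.card_biUnion_le_card_mul _ _ _ fun x _ => hdeg x
    _ ≤ m * κ := by gcongr; exact card_live_le a m f i

lemma card_live_filter_add_of_mem_clashing (hsymm : ∀ x y, R x y → R y x)
    (hdeg : ∀ x, (Finset.univ.filter (R x)).card ≤ κ) (x : α) :
    (live R a m f i).card ≤ {y ∈ live R a m f i | ¬R y x}.card +
      κ * if x ∈ clashing R a m i f then 1 else 0 := by
  split_ifs with hclash
  · have hkilled : {y ∈ live R a m f i | R y x}.card ≤ κ :=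
      (Finset.card_le_card fun y hy => by
        simpa using hsymm _ _ (Finset.mem_filter.1 hy).2).trans (hdeg x)
    have := Finset.card_filter_add_card_filter_not (s := live R a m f i) (R · x)
    omega
  · rw [Finset.filter_true_of_mem (by simpa [clashing] using hclash)]
    omega

/-- Every index of the first phase creates a live value, and only a clash destroys some, at most
`κ` of them. -/
lemma min_le_card_live_add (hrefl : ∀ x, R x x) (hsymm : ∀ x y, R x y → R y x)
    (hdeg : ∀ x, (Finset.univ.filter (R x)).card ≤ κ) (a m w : ℕ) (f : ℕ → α) :
    min w m ≤ (live R a m f (a + w)).card + κ * (hitTimes (clashing R a m) a w f).card := by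
  induction w with
  | zero => simp
  | succ w ih =>
    have hfilter := card_live_filter_add_of_mem_clashing (a := a) (m := m) (i := a + w) (f := f)
      hsymm hdeg (f (a + w))
    rw [← add_assoc, card_hitTimes_succ, mul_add]
    by_cases hw : w < m
    · rw [live_succ_of_lt (by omega) (by omega), Finset.card_insert_of_notMem (by simp [hrefl])]
      omega
    · rw [live_succ_of_le (by omega)]
      omega

lemma mul_le_card_live (hrefl : ∀ x, R x x) (hsymm : ∀ x y, R x y → R y x)
    (hdeg : ∀ x, (Finset.univ.filter (R x)).card ≤ κ) {s : ℕ} (hai : a + 2 * κ * s ≤ i)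
    (hiw : i ≤ a + w) (hclash : (hitTimes (clashing R a (2 * κ * s)) a w f).card ≤ s) :
    κ * s ≤ (live R a (2 * κ * s) f i).card := by
  obtain ⟨v, rfl⟩ := Nat.exists_eq_add_of_le (show a ≤ i by omega)
  have hv := min_le_card_live_add hrefl hsymm hdeg a (2 * κ * s) v f
  rw [min_eq_right (by omega)] at hv
  have hclash' : (hitTimes (clashing R a (2 * κ * s)) a v f).card ≤ s :=
    (Finset.card_le_card (hitTimes_subset le_rfl hiw f)).trans hclash
  have := Nat.mul_le_mul_left κ hclash'
  linarith

lemma dependsOn_clashing (a m i : ℕ) : DependsOn (clashing R a m i) (Finset.range i) := by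
  intro f g hfg
  have hlive := dependsOn_live (R := R) a m i fun x hx =>
    hfg x (Finset.mem_range.2 (Finset.mem_Ico.1 hx).2)
  simp only [clashing, hlive]

variable {Ω : Type*} [MeasurableSpace Ω] {μ : Measure Ω} [IsProbabilityMeasure μ]
  [MeasurableSpace α] [DiscreteMeasurableSpace α] {E : ℕ → Ω → α}

namespace IsIIDUniform

lemma measureReal_le_card_clashTimes_le (hE : IsIIDUniform μ E)
    (hdeg : ∀ x, (Finset.univ.filter (R x)).card ≤ κ) (a : ℕ) {s : ℕ}
    (hs : 32 * κ ^ 3 * s ≤ Fintype.card α) :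
    μ.real {ω | s ≤ (hitTimes (clashing R a (2 * κ * s)) a (4 * κ * s) (E · ω)).card} ≤
      Real.exp (-(s / 2 : ℝ)) := by
  have : Nonempty α := (nonempty_of_isProbabilityMeasure μ).map (E 0)
  have hN : (0 : ℝ) < Fintype.card α := by positivity
  have hs' : 32 * (κ : ℝ) ^ 3 * s ≤ Fintype.card α := by exact_mod_cast hs
  set p : ℝ := 2 * κ ^ 2 * s / Fintype.card α with hp
  have hclash (i : ℕ) (f : ℕ → α) :
      ((clashing R a (2 * κ * s) i f).card : ℝ) ≤ p * Fintype.card α := by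
    rw [hp, div_mul_cancel₀ _ hN.ne']
    calc ((clashing R a (2 * κ * s) i f).card : ℝ) ≤ ((2 * κ * s * κ : ℕ) : ℝ) :=
          Nat.cast_le.2 (card_clashing_le hdeg a _ i f)
      _ = 2 * κ ^ 2 * s := by push_cast; ring
  have hexp : 2 * p * (4 * κ * s : ℕ) - s ≤ -(s / 2 : ℝ) := by
    have : 2 * p * (4 * κ * s : ℕ) = 32 * κ ^ 3 * s / Fintype.card α * (s / 2) := by
      rw [hp]; push_cast; ring
    have : 32 * (κ : ℝ) ^ 3 * s / Fintype.card α * (s / 2) ≤ 1 * (s / 2) := by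
      gcongr
      exact (div_le_one hN).2 hs'
    linarith
  have h := hE.measureReal_le_card_hitTimes_le (dependsOn_clashing a (2 * κ * s)) a (4 * κ * s)
    (by positivity) (fun i _ f => hclash i f) s
  simp only [Nat.cast_le] at h
  exact h.trans (Real.exp_le_exp.2 hexp)

lemma measureReal_live_large_and_card_repeatTimes_le_le (hE : IsIIDUniform μ E) (a : ℕ)
    {m l ρ : ℕ} (hl : l ≤ Fintype.card α) (hρ : 4 * ρ * Fintype.card α ≤ l * m) :
    μ.real {ω | (∀ i ∈ Finset.Ico (a + m) (a + m + m), l ≤ (live R a m (E · ω) i).card) ∧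
      (repeatTimes R a m (E · ω)).card ≤ ρ} ≤ Real.exp (-ρ) := by
  have : Nonempty α := (nonempty_of_isProbabilityMeasure μ).map (E 0)
  have hN : (0 : ℝ) < Fintype.card α := by positivity
  have h := hE.measureReal_card_hitTimes_le_le (A := fun i f => live R a m f i)
    (fun i => (dependsOn_live a m i).mono fun x hx =>
      Finset.mem_range.2 (Finset.mem_Ico.1 hx).2) (a + m) m
    (p := l / Fintype.card α) (by positivity)
    ((div_le_one hN).2 (by exact_mod_cast hl)) ρ
  simp only [div_mul_cancel₀ _ hN.ne', Nat.cast_le] at h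
  refine h.trans (Real.exp_le_exp.2 ?_)
  have : (4 * ρ : ℝ) ≤ l / Fintype.card α * m := by
    rw [div_mul_eq_mul_div, le_div_iff₀ hN]
    exact_mod_cast hρ
  linarith

lemma measureReal_card_repeatTimes_le_le (hE : IsIIDUniform μ E) (hrefl : ∀ x, R x x)
    (hsymm : ∀ x y, R x y → R y x) (hdeg : ∀ x, (Finset.univ.filter (R x)).card ≤ κ) (a : ℕ)
    {s ρ : ℕ} (hs : 32 * κ ^ 3 * s ≤ Fintype.card α)
    (hρ : 2 * ρ * Fintype.card α ≤ κ ^ 2 * s ^ 2) :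
    μ.real {ω | (repeatTimes R a (2 * κ * s) (E · ω)).card ≤ ρ} ≤ 2 * Real.exp (-ρ) := by
  have ⟨ω₀⟩ := nonempty_of_isProbabilityMeasure μ
  have : Nonempty α := ⟨E 0 ω₀⟩
  have hκ : 0 < κ :=
    (Finset.card_pos.2 ⟨E 0 ω₀, by simp [hrefl]⟩).trans_le (hdeg (E 0 ω₀))
  have hκs {d : ℕ} (hd : d ≤ 3) : κ ^ d * s ≤ Fintype.card α :=
    (Nat.mul_le_mul_right s <| (Nat.pow_le_pow_right hκ hd).trans <|
      Nat.le_mul_of_pos_left _ (by norm_num)).trans hs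
  have hρs : 2 * ρ ≤ s := by
    refine Nat.le_of_mul_le_mul_right (hρ.trans ?_) (Fintype.card_pos (α := α))
    calc κ ^ 2 * s ^ 2 = s * (κ ^ 2 * s) := by ring
      _ ≤ s * Fintype.card α := by gcongr; exact hκs (by norm_num)
  have hfew := hE.measureReal_le_card_clashTimes_le hdeg a hs
  have hmany := hE.measureReal_live_large_and_card_repeatTimes_le_le (R := R) a
    (m := 2 * κ * s) (ρ := ρ) (by simpa using hκs (d := 1) (by norm_num)) (by linarith)
  have hsub : {ω | (repeatTimes R a (2 * κ * s) (E · ω)).card ≤ ρ} ⊆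
      {ω | s ≤ (hitTimes (clashing R a (2 * κ * s)) a (4 * κ * s) (E · ω)).card} ∪
      {ω | (∀ i ∈ Finset.Ico (a + 2 * κ * s) (a + 2 * κ * s + 2 * κ * s),
          κ * s ≤ (live R a (2 * κ * s) (E · ω) i).card) ∧
        (repeatTimes R a (2 * κ * s) (E · ω)).card ≤ ρ} := by
    intro ω hω
    refine or_iff_not_imp_left.2 fun hclash => ⟨fun i hi => ?_, hω⟩
    rw [Finset.mem_Ico] at hi
    exact mul_le_card_live hrefl hsymm hdeg hi.1 (by linarith) (not_le.1 hclash).le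
  calc _ ≤ _ := (measureReal_mono hsub).trans (measureReal_union_le _ _)
    _ ≤ Real.exp (-(s / 2 : ℝ)) + Real.exp (-ρ) := add_le_add hfew hmany
    _ ≤ Real.exp (-ρ) + Real.exp (-ρ) := by
        gcongr
        have : (2 * ρ : ℝ) ≤ s := by exact_mod_cast hρs
        linarith
    _ = 2 * Real.exp (-ρ) := (two_mul _).symm

end IsIIDUniform

end Repetitions

section Swaps

variable {V L : Type*} [DecidableEq V] {T : SimpleGraph V}

/-- The transposition of the endpoints of an edge. -/
def edgeSwap (x : T.edgeSet) : Equiv.Perm V :=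
  Sym2.lift ⟨fun u v => Equiv.swap u v, Equiv.swap_comm⟩ x.1

lemma edgeSwap_of_notMem {x : T.edgeSet} {v : V} (hv : v ∉ x.1) : edgeSwap x v = v := by
  obtain ⟨x, hx⟩ := x
  induction x with
  | _ a b =>
    simp only [Sym2.mem_iff, not_or] at hv
    exact Equiv.swap_apply_of_ne_of_ne hv.1 hv.2

@[simp]
lemma edgeSwap_edgeSwap (x : T.edgeSet) (v : V) : edgeSwap x (edgeSwap x v) = v := by
  obtain ⟨x, hx⟩ := x
  induction x with
  | _ a b => exact Equiv.swap_apply_self a b v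

lemma edgeSwap_mem_iff {x : T.edgeSet} {v : V} : edgeSwap x v ∈ x.1 ↔ v ∈ x.1 := by
  obtain ⟨x, hx⟩ := x
  induction x with
  | _ a b =>
    simp only [edgeSwap, Sym2.lift_mk, Sym2.mem_iff, Equiv.swap_apply_def]
    grind

lemma adj_edgeSwap {x : T.edgeSet} {v : V} (hv : v ∈ x.1) : T.Adj v (edgeSwap x v) := by
  obtain ⟨x, hx⟩ := x
  induction x with
  | _ a b =>
    rw [SimpleGraph.mem_edgeSet] at hx
    rcases Sym2.mem_iff.1 hv with rfl | rfl
    · simpa [edgeSwap] using hx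
    · simpa [edgeSwap] using hx.symm

lemma dist_edgeSwap_le (hT : T.Connected) (x : T.edgeSet) (v w : V) :
    T.dist (edgeSwap x v) w ≤ T.dist v w + if v ∈ x.1 then 1 else 0 := by
  split_ifs with h
  · have htriangle := hT.dist_triangle (u := edgeSwap x v) (v := v) (w := w)
    rw [SimpleGraph.dist_eq_one_iff_adj.2 (adj_edgeSwap h).symm] at htriangle
    omega
  · rw [edgeSwap_of_notMem h, add_zero]

variable [Fintype L]

lemma card_filter_mem_edge_le (x : T.edgeSet) (M : L ≃ V) :
    (Finset.univ.filter fun l => M l ∈ x.1).card ≤ 2 := by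
  classical
  obtain ⟨x, hx⟩ := x
  induction x with
  | _ a b =>
    calc _ ≤ ({M.symm a, M.symm b} : Finset L).card := by
          refine Finset.card_le_card fun l hl => ?_
          simpa [Equiv.eq_symm_apply] using hl
      _ ≤ 2 := Finset.card_le_two

/-- The amount by which swapping the true locations `M` of the labels at the endpoints of `x`
increases the overall distance to `H` less than it could, namely by `2`. -/
noncomputable def gain (x : T.edgeSet) (M : L ≃ V) (H : L → V) : ℤ :=
  2 - ∑ l, ((T.dist (edgeSwap x (M l)) (H l) : ℤ) - T.dist (M l) (H l))

lemma gain_nonneg (hT : T.Connected) (x : T.edgeSet) (M : L ≃ V) (H : L → V) :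
    0 ≤ gain x M H := by
  have hle (l : L) : (T.dist (edgeSwap x (M l)) (H l) : ℤ) - T.dist (M l) (H l) ≤
      if M l ∈ x.1 then 1 else 0 := by
    have := dist_edgeSwap_le hT x (M l) (H l)
    zify at this
    linarith
  have hsum := Finset.sum_le_sum fun l (_ : l ∈ Finset.univ) => hle l
  rw [Finset.sum_boole] at hsum
  have := card_filter_mem_edge_le x M
  rw [gain]
  omega

lemma gain_add_gain_eq_four {x : T.edgeSet} {M M' : L ≃ V} {H H' : L → V}
    (h : ∀ l, M l ∈ x.1 ∨ M' l ∈ x.1 → M' l = edgeSwap x (M l) ∧ H' l = H l) :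
    gain x M H + gain x M' H' = 4 := by
  have hcancel (l : L) :
      ((T.dist (edgeSwap x (M l)) (H l) : ℤ) - T.dist (M l) (H l)) +
        ((T.dist (edgeSwap x (M' l)) (H' l) : ℤ) - T.dist (M' l) (H' l)) = 0 := by
    by_cases hl : M l ∈ x.1 ∨ M' l ∈ x.1
    · obtain ⟨hM, hH⟩ := h l hl
      rw [hM, hH, edgeSwap_edgeSwap]
      ring
    · obtain ⟨hM, hM'⟩ := not_or.1 hl
      rw [edgeSwap_of_notMem hM, edgeSwap_of_notMem hM']
      ring
  have hsum := Finset.sum_eq_zero fun l (_ : l ∈ Finset.univ) => hcancel l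
  rw [Finset.sum_add_distrib] at hsum
  rw [gain, gain]
  linarith

end Swaps

section Meets

variable {V : Type*} {T : SimpleGraph V}

/-- Two edges meet if they have a common endpoint. In particular, every edge meets itself. -/
def Meets (x y : T.edgeSet) : Prop := ∃ v, v ∈ x.1 ∧ v ∈ y.1

noncomputable instance : DecidableRel (Meets (T := T)) := Classical.decRel _

lemma Meets.refl (x : T.edgeSet) : Meets x x :=
  ⟨x.1.out.1, Sym2.out_fst_mem x.1, Sym2.out_fst_mem x.1⟩

lemma Meets.symm {x y : T.edgeSet} (h : Meets x y) : Meets y x :=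
  let ⟨v, hx, hy⟩ := h
  ⟨v, hy, hx⟩

lemma card_filter_meets_le [Fintype V] [DecidableRel T.Adj] (x : T.edgeSet) :
    (Finset.univ.filter (Meets x)).card ≤ 2 * T.maxDegree := by
  classical
  obtain ⟨x, hx⟩ := x
  induction x with
  | _ a b =>
    calc (Finset.univ.filter (Meets ⟨s(a, b), hx⟩)).card
        = ((Finset.univ.filter (Meets ⟨s(a, b), hx⟩)).map (Function.Embedding.subtype _)).card :=
          (Finset.card_map _).symm
      _ ≤ (T.incidenceFinset a ∪ T.incidenceFinset b).card := by
          refine Finset.card_le_card fun y hy => ?_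
          simp only [Finset.mem_map, Finset.mem_filter_univ, Function.Embedding.subtype_apply] at hy
          obtain ⟨⟨y, hyT⟩, ⟨v, hv, hvy⟩, rfl⟩ := hy
          rw [Finset.mem_union, T.mem_incidenceFinset, T.mem_incidenceFinset]
          rcases Sym2.mem_iff.1 hv with rfl | rfl
          exacts [.inl ⟨hyT, hvy⟩, .inr ⟨hyT, hvy⟩]
      _ ≤ T.maxDegree + T.maxDegree := by
          refine (Finset.card_union_le _ _).trans ?_
          rw [T.card_incidenceFinset_eq_degree, T.card_incidenceFinset_eq_degree]
          exact add_le_add (T.degree_le_maxDegree a) (T.degree_le_maxDegree b)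
      _ = 2 * T.maxDegree := (two_mul _).symm

end Meets

section Cancellation

variable {V L : Type*} [DecidableEq V] {T : SimpleGraph V} {e : ℕ → T.edgeSet} {M : ℕ → L ≃ V}

/-- In the sequence `M` of labelings, the labels at the endpoints of the edge `e i` are swapped in
the step from `M i` to `M (i + 1)`. -/
def IsSwapSequence (e : ℕ → T.edgeSet) (M : ℕ → L ≃ V) : Prop :=
  ∀ i l, M (i + 1) l = edgeSwap (e i) (M i l)

lemma IsSwapSequence.eq_of_not_meets (hM : IsSwapSequence e M) {x : T.edgeSet} {a b : ℕ}
    (hab : a ≤ b) (hx : ∀ i, a ≤ i → i < b → ¬Meets x (e i)) {l : L}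
    (hl : M a l ∈ x.1 ∨ M b l ∈ x.1) : M b l = M a l := by
  induction b, hab using Nat.le_induction with
  | base => rfl
  | succ b hab ih =>
    have hfix {v : V} (hv : v ∈ x.1) : edgeSwap (e b) v = v :=
      edgeSwap_of_notMem fun hv' => hx b hab (by omega) ⟨v, hv, hv'⟩
    specialize ih fun i hi hib => hx i hi (by omega)
    rw [hM] at hl ⊢
    rcases hl with hl | hl
    · rw [ih (.inl hl), hfix hl]
    · have hb : edgeSwap (e b) (M b l) = M b l := by simpa using (hfix hl).symm
      rw [hb] at hl ⊢
      exact ih (.inr hl)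

lemma eq_of_meets_of_mem_repeatTimes {a m i i' : ℕ} (hi : i ∈ repeatTimes Meets a m e)
    (hi' : i' ∈ repeatTimes Meets a m e) (h : Meets (e i) (e i')) : i = i' := by
  wlog hlt : i < i' generalizing i i'
  · rcases (not_lt.1 hlt).eq_or_lt with heq | hlt
    exacts [heq.symm, (this hi' hi h.symm hlt).symm]
  obtain ⟨-, -, u, -, hu, -, hbetween⟩ := mem_repeatTimes.1 hi'
  exact absurd h.symm (hbetween i (hu.trans_le (mem_repeatTimes.1 hi).1) hlt)

/-- At the common time `a + m` the edges of the repetitions are disjoint and the labels at their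
endpoints are already in place, so that every label occurs at most once. -/
lemma IsSwapSequence.card_filter_repeatTimes_le (hM : IsSwapSequence e M) (a m : ℕ)
    (S : Finset L) :
    {i ∈ repeatTimes Meets a m e | ∃ l ∈ S, M i l ∈ (e i).1}.card ≤ S.card := by
  refine Finset.card_le_card_of_forall_subsingleton (fun i l => M (a + m) l ∈ (e i).1)
    (fun i hi => ?_) fun l _ i hi i' hi' => ?_
  · obtain ⟨hi, l, hl, hmem⟩ := Finset.mem_filter.1 hi
    obtain ⟨hmi, -, u, -, hu, -, hbetween⟩ := mem_repeatTimes.1 hi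
    refine ⟨l, hl, ?_⟩
    rwa [← hM.eq_of_not_meets hmi (fun v hv => hbetween v (by omega)) (.inr hmem)]
  · exact eq_of_meets_of_mem_repeatTimes (Finset.mem_filter.1 hi.1).1
      (Finset.mem_filter.1 hi'.1).1 ⟨_, hi.2, hi'.2⟩

variable [Fintype L] {H : ℕ → L → V}

lemma IsSwapSequence.gain_add_gain_eq_four (hM : IsSwapSequence e M) {u i : ℕ} (hui : u < i)
    (he : e u = e i) (hbetween : ∀ v, u < v → v < i → ¬Meets (e i) (e v))
    (hH : ∀ l, M i l ∈ (e i).1 → H i l = H u l) :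
    gain (e u) (M u) (H u) + gain (e i) (M i) (H i) = 4 := by
  have hconst (l : L) (hl : M (u + 1) l ∈ (e i).1 ∨ M i l ∈ (e i).1) : M i l = M (u + 1) l :=
    hM.eq_of_not_meets hui (fun v hv => hbetween v hv) hl
  have hmem (l : L) : M u l ∈ (e i).1 ↔ M (u + 1) l ∈ (e i).1 := by
    rw [hM, he, edgeSwap_mem_iff]
  rw [he]
  refine LabelTracking.gain_add_gain_eq_four fun l hl => ?_
  rw [hmem] at hl
  have hMl := hconst l hl
  refine ⟨by rw [hMl, hM, he], hH l (hl.elim (fun h => hMl ▸ h) id)⟩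

lemma sum_comp_add_sum_le {g : ℕ → ℤ} (hg : ∀ i, 0 ≤ g i) {U : Finset ℕ} {p : ℕ → ℕ}
    {a b c : ℕ} (hinj : Set.InjOn p U) (hp : ∀ i ∈ U, a ≤ p i ∧ p i < b)
    (hU : ∀ i ∈ U, b ≤ i ∧ i < c) (hab : a ≤ b) (hbc : b ≤ c) :
    ∑ i ∈ U, (g (p i) + g i) ≤ ∑ i ∈ Finset.Ico a c, g i := by
  rw [Finset.sum_add_distrib, ← Finset.sum_image hinj, ← Finset.sum_Ico_consecutive g hab hbc]
  gcongr
  · exact fun i _ _ => hg i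
  · exact Finset.image_subset_iff.2 fun i hi => Finset.mem_Ico.2 (hp i hi)
  · exact fun i _ _ => hg i
  · exact fun i hi => Finset.mem_Ico.2 (hU i hi)

/-- A repetition at whose edge no label of `S` resides, together with the earlier choice of the
same edge, is a pair of cancelling swaps. -/
lemma IsSwapSequence.four_mul_card_repeatTimes_le (hT : T.Connected) (hM : IsSwapSequence e M)
    (a m : ℕ) {S : Finset L} (hH : ∀ i ∈ Finset.Ico a (a + 2 * m), ∀ l ∉ S, H i l = H a l) :
    4 * ((repeatTimes Meets a m e).card : ℤ) ≤
      ∑ i ∈ Finset.Ico a (a + 2 * m), gain (e i) (M i) (H i) + 4 * S.card := by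
  have hpartner (i : ℕ) (hi : i ∈ repeatTimes Meets a m e) := (mem_repeatTimes.1 hi).2.2
  choose! p hap hpm hpe hbetween using hpartner
  set U := {i ∈ repeatTimes Meets a m e | ¬∃ l ∈ S, M i l ∈ (e i).1}
  have hUrep {i : ℕ} (hi : i ∈ U) : i ∈ repeatTimes Meets a m e := (Finset.mem_filter.1 hi).1
  have hUmem {i : ℕ} (hi : i ∈ U) : a + m ≤ i ∧ i < a + 2 * m :=
    (mem_repeatTimes.1 (hUrep hi)).imp_right And.left
  have hcard : (repeatTimes Meets a m e).card ≤ S.card + U.card := by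
    rw [← Finset.card_filter_add_card_filter_not fun i => ∃ l ∈ S, M i l ∈ (e i).1]
    exact Nat.add_le_add_right (hM.card_filter_repeatTimes_le a m S) _
  have hpair (i : ℕ) (hi : i ∈ U) :
      gain (e (p i)) (M (p i)) (H (p i)) + gain (e i) (M i) (H i) = 4 := by
    have hai := hUmem hi
    have hapi := hap i (hUrep hi)
    have hpim := hpm i (hUrep hi)
    refine hM.gain_add_gain_eq_four (by omega) (hpe i (hUrep hi)) (hbetween i (hUrep hi))
      fun l hl => ?_
    have hlS : l ∉ S := fun hlS => (Finset.mem_filter.1 hi).2 ⟨l, hlS, hl⟩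
    rw [hH i (by simp; omega) l hlS, hH (p i) (by simp; omega) l hlS]
  have hinj : Set.InjOn p U := fun i hi i' hi' heq =>
    eq_of_meets_of_mem_repeatTimes (hUrep hi) (hUrep hi') <| by
      rw [← hpe i (hUrep hi), ← hpe i' (hUrep hi'), heq]
      exact Meets.refl _
  have hsum := sum_comp_add_sum_le (fun i => gain_nonneg hT (e i) (M i) (H i)) hinj
    (fun i hi => ⟨hap i (hUrep hi), hpm i (hUrep hi)⟩) (fun i => hUmem) (by omega) (by omega)
  rw [Finset.sum_congr rfl hpair, Finset.sum_const, nsmul_eq_mul] at hsum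
  omega

end Cancellation

section Steps

variable {V : Type*} {T : SimpleGraph V} {n : ℕ}

lemma length_treePath (hT : T.IsTree) (u w : V) : (treePath hT u w).length = T.dist u w := by
  obtain ⟨p, hp, hlen⟩ := hT.connected.exists_path_of_dist u w
  have hpath : (treePath hT u w).IsPath := (hT.existsUnique_path u w).choose_spec.1
  rw [← hlen, (hT.existsUnique_path u w).unique hp hpath]

lemma dist_firstDart_snd_add_one (hT : T.IsTree) {u w : V} (h : u ≠ w) :
    T.dist w ((treePath hT u w).firstDart (SimpleGraph.Walk.not_nil_of_ne h)).snd + 1 =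
      T.dist w u := by
  have hnil : ¬(treePath hT u w).Nil := SimpleGraph.Walk.not_nil_of_ne h
  have htail := SimpleGraph.dist_le (treePath hT u w).tail
  have hlen := SimpleGraph.Walk.length_tail_add_one hnil
  have htriangle := hT.connected.dist_triangle (u := u) (v := (treePath hT u w).snd) (w := w)
  rw [SimpleGraph.dist_eq_one_iff_adj.2 ((treePath hT u w).adj_snd hnil)] at htriangle
  rw [length_treePath] at hlen
  change T.dist w (treePath hT u w).snd + 1 = _
  rw [T.dist_comm (u := w), T.dist_comm (u := w)]
  omega

lemma dist_lt_of_equiv (hT : T.Connected) (M : Fin n ≃ V) (u v : V) : T.dist u v < n := by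
  have : Fintype V := Fintype.ofEquiv _ M
  obtain ⟨p, hp, hlen⟩ := hT.exists_path_of_dist u v
  rw [← hlen]
  simpa [Fintype.card_congr M.symm] using hp.length_lt

/-- The contribution of the label `l` to the overall distance. -/
noncomputable def labelDist (T : SimpleGraph V) (s : State V n) (l : Fin n) : ℕ :=
  T.dist (s.truth l) (s.hyp l)

lemma distance_le_mul_self (hT : T.Connected) (s : State V n) : s.distance T ≤ n * n := by
  refine (Finset.sum_le_card_nsmul _ _ n fun l _ => ?_).trans_eq (by simp)
  exact (dist_lt_of_equiv hT s.truth _ _).le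

variable [DecidableEq V]

lemma algorithmStep_cases [NeZero n] (hT : T.IsTree) (s : State V n) :
    (labelDist T s s.current = 0 ∧ algorithmStep hT s = { s with finished := s.finished + 1 }) ∨
      ∃ v, algorithmStep hT s = { s with hyp := Function.update s.hyp s.current v } ∧
        T.dist (s.truth s.current) v + 1 = labelDist T s s.current := by
  by_cases h : s.hyp s.current = s.truth s.current
  · exact .inl ⟨by rw [labelDist, h, T.dist_self], by rw [algorithmStep, oracle, dif_pos h]⟩
  · exact .inr ⟨_, by rw [algorithmStep, oracle, dif_neg h], dist_firstDart_snd_add_one hT h⟩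

lemma truth_algorithmStep [NeZero n] (hT : T.IsTree) (s : State V n) :
    (algorithmStep hT s).truth = s.truth := by
  obtain ⟨-, h⟩ | ⟨v, h, -⟩ := algorithmStep_cases hT s <;> rw [h]

lemma hyp_algorithmStep_of_ne [NeZero n] (hT : T.IsTree) (s : State V n) {l : Fin n}
    (hl : l ≠ s.current) : (algorithmStep hT s).hyp l = s.hyp l := by
  obtain ⟨-, h⟩ | ⟨v, h, -⟩ := algorithmStep_cases hT s <;> rw [h]
  exact Function.update_of_ne hl _ _

lemma finished_le_algorithmStep [NeZero n] (hT : T.IsTree) (s : State V n) :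
    s.finished ≤ (algorithmStep hT s).finished := by
  obtain ⟨-, h⟩ | ⟨v, h, -⟩ := algorithmStep_cases hT s <;> simp [h]

lemma finished_algorithmStep_le [NeZero n] (hT : T.IsTree) (s : State V n) :
    (algorithmStep hT s).finished ≤ s.finished + 1 := by
  obtain ⟨-, h⟩ | ⟨v, h, -⟩ := algorithmStep_cases hT s <;> simp [h]

lemma labelDist_current_eq_zero [NeZero n] {hT : T.IsTree} {s : State V n}
    (h : s.finished < (algorithmStep hT s).finished) : labelDist T s s.current = 0 := by
  obtain ⟨h0, -⟩ | ⟨v, hv, -⟩ := algorithmStep_cases hT s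
  · exact h0
  · simp [hv] at h

lemma labelDist_algorithmStep_of_ne [NeZero n] (hT : T.IsTree) (s : State V n) {l : Fin n}
    (hl : l ≠ s.current) : labelDist T (algorithmStep hT s) l = labelDist T s l := by
  rw [labelDist, truth_algorithmStep, hyp_algorithmStep_of_ne hT s hl, labelDist]

lemma labelDist_algorithmStep_current [NeZero n] (hT : T.IsTree) (s : State V n) :
    labelDist T (algorithmStep hT s) s.current + 1 + s.finished =
      labelDist T s s.current + (algorithmStep hT s).finished := by
  obtain ⟨-, h⟩ | ⟨v, h, hv⟩ := algorithmStep_cases hT s <;> rw [h]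
  · simp only [labelDist]
    ring
  · rw [← hv]
    simp only [labelDist, Function.update_self]

lemma labelDist_algorithmStep_le [NeZero n] (hT : T.IsTree) (s : State V n) (l : Fin n) :
    labelDist T (algorithmStep hT s) l ≤ labelDist T s l := by
  rcases eq_or_ne l s.current with rfl | hl
  · have := labelDist_algorithmStep_current hT s
    have := finished_algorithmStep_le hT s
    omega
  · exact (labelDist_algorithmStep_of_ne hT s hl).le

lemma distance_algorithmStep [NeZero n] (hT : T.IsTree) (s : State V n) :
    (algorithmStep hT s).distance T + 1 + s.finished =
      s.distance T + (algorithmStep hT s).finished := by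
  change ∑ l, labelDist T (algorithmStep hT s) l + 1 + _ = ∑ l, labelDist T s l + _
  rw [← Finset.add_sum_erase _ _ (Finset.mem_univ s.current),
    ← Finset.add_sum_erase _ (labelDist T s) (Finset.mem_univ s.current),
    Finset.sum_congr rfl fun l hl => labelDist_algorithmStep_of_ne hT s (Finset.ne_of_mem_erase hl)]
  have := labelDist_algorithmStep_current hT s
  omega

lemma labelDist_evolverStep_le (hT : T.Connected) (x : T.edgeSet) (s : State V n) (l : Fin n) :
    labelDist T (evolverStep x s) l ≤ labelDist T s l + if s.truth l ∈ x.1 then 1 else 0 :=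
  dist_edgeSwap_le hT x (s.truth l) (s.hyp l)

lemma distance_evolverStep_add_gain (x : T.edgeSet) (s : State V n) :
    ((evolverStep x s).distance T : ℤ) + gain x s.truth s.hyp = s.distance T + 2 := by
  change ((∑ l, T.dist (edgeSwap x (s.truth l)) (s.hyp l) : ℕ) : ℤ) + _ = _
  rw [gain, Finset.sum_sub_distrib, State.distance]
  push_cast
  ring

end Steps

section Trajectory

lemma two_mul_div_add_le {c t t' : ℕ} (hc : 2 ≤ c) (h : t ≤ t') :
    2 * (t' / c) + t ≤ 2 * (t / c) + t' + 1 := by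
  have hmono := Nat.div_le_div_right (c := c) h
  have ht := Nat.lt_mul_div_succ t (by omega : 0 < c)
  have ht' := Nat.mul_div_le t' c
  obtain ⟨d, hd⟩ := Nat.exists_eq_add_of_le hmono
  obtain rfl | d := d
  · omega
  · rw [hd] at ht' ⊢
    nlinarith [Nat.mul_le_mul_right d hc]

variable {V : Type*} [DecidableEq V] {T : SimpleGraph V} {n : ℕ}

/-- The gain of the `i`-th swap, which takes place at the end of the time unit before time
`c * (i + 1)`. -/
noncomputable def swapGain (c : ℕ) (e : ℕ → T.edgeSet) (s : ℕ → State V n) (i : ℕ) : ℤ :=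
  gain (e i) (s (c * i)).truth (s (c * (i + 1))).hyp

lemma swapGain_nonneg (hT : T.Connected) (c : ℕ) (e : ℕ → T.edgeSet) (s : ℕ → State V n) (i : ℕ) :
    0 ≤ swapGain c e s i :=
  gain_nonneg hT _ _ _

variable [NeZero n]

/-- The states `s 0, s 1, …` arise from the initial state `s 0` by a step of the algorithm in every
time unit and a step of the evolver, along the edges `e 0, e 1, …`, at the end of every `c`-th one.
In contrast to `run`, the initial state is arbitrary. -/
def IsTrajectory (hT : T.IsTree) (c : ℕ) (e : ℕ → T.edgeSet) (s : ℕ → State V n) : Prop :=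
  ∀ t, s (t + 1) =
    if c ∣ t + 1 then evolverStep (e (t / c)) (algorithmStep hT (s t))
    else algorithmStep hT (s t)

lemma isTrajectory_run (hT : T.IsTree) (c : ℕ) (M₀ : Fin n ≃ V) (H₀ : Fin n → V)
    (e : ℕ → T.edgeSet) : IsTrajectory hT c e (run hT c M₀ H₀ e) :=
  fun _ => rfl

namespace IsTrajectory

variable {hT : T.IsTree} {c : ℕ} {e : ℕ → T.edgeSet} {s : ℕ → State V n}

lemma finished_succ (hs : IsTrajectory hT c e s) (t : ℕ) :
    (s (t + 1)).finished = (algorithmStep hT (s t)).finished := by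
  rw [hs]
  split_ifs <;> rfl

lemma hyp_succ (hs : IsTrajectory hT c e s) (t : ℕ) :
    (s (t + 1)).hyp = (algorithmStep hT (s t)).hyp := by
  rw [hs]
  split_ifs <;> rfl

lemma finished_succ_le (hs : IsTrajectory hT c e s) (t : ℕ) :
    (s (t + 1)).finished ≤ (s t).finished + 1 := by
  rw [hs.finished_succ]
  exact finished_algorithmStep_le hT (s t)

lemma finished_mono (hs : IsTrajectory hT c e s) {t t' : ℕ} (h : t ≤ t') :
    (s t).finished ≤ (s t').finished :=
  monotone_nat_of_le_succ (f := fun t => (s t).finished)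
    (fun t => (finished_le_algorithmStep hT (s t)).trans_eq (hs.finished_succ t).symm) h

lemma truth_eq (hs : IsTrajectory hT c e s) (t : ℕ) : (s t).truth = (s (c * (t / c))).truth := by
  induction t with
  | zero => simp
  | succ t ih =>
    by_cases h : c ∣ t + 1
    · rw [Nat.mul_div_cancel' h]
    · rw [Nat.succ_div_of_not_dvd h, hs, if_neg h, truth_algorithmStep, ih]

lemma isSwapSequence (hs : IsTrajectory hT c e s) (hc : 0 < c) :
    IsSwapSequence e fun i => (s (c * i)).truth := by
  intro i l
  have ht : c * (i + 1) = c * i + (c - 1) + 1 := by rw [mul_add, mul_one]; omega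
  have hdiv : (c * i + (c - 1)) / c = i := by
    rw [Nat.mul_add_div hc, Nat.div_eq_of_lt (by omega), add_zero]
  have hdvd : c ∣ c * i + (c - 1) + 1 := ht ▸ dvd_mul_right c (i + 1)
  have htruth := hs.truth_eq (c * i + (c - 1))
  dsimp only
  rw [hdiv] at htruth
  rw [ht, hs, if_pos hdvd, hdiv, ← htruth]
  exact congrArg (edgeSwap (e i)) (by rw [truth_algorithmStep])

lemma hyp_eq_of_current_ne (hs : IsTrajectory hT c e s) {t t' : ℕ} (htt' : t ≤ t') {l : Fin n}
    (hl : ∀ u, t ≤ u → u < t' → l ≠ (s u).current) : (s t').hyp l = (s t).hyp l := by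
  induction t', htt' using Nat.le_induction with
  | base => rfl
  | succ t' htt' ih =>
    rw [hs.hyp_succ, hyp_algorithmStep_of_ne hT _ (hl t' htt' t'.lt_succ_self),
      ih fun u hu hut' => hl u hu (hut'.trans t'.lt_succ_self)]

lemma distance_add_sum_swapGain (hs : IsTrajectory hT c e s) (t : ℕ) :
    ((s t).distance T : ℤ) + ∑ i ∈ Finset.range (t / c), swapGain c e s i + t + (s 0).finished =
      (s 0).distance T + (s t).finished + 2 * (t / c : ℕ) := by
  induction t with
  | zero => simp
  | succ t ih =>
    have halg := distance_algorithmStep hT (s t)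
    rw [← hs.finished_succ] at halg
    by_cases h : c ∣ t + 1
    · have hgain := distance_evolverStep_add_gain (e (t / c)) (algorithmStep hT (s t))
      have htime : t + 1 = c * (t / c + 1) := by
        rw [← Nat.succ_div_of_dvd h, Nat.mul_div_cancel' h]
      rw [truth_algorithmStep, hs.truth_eq, ← hs.hyp_succ, htime, ← swapGain] at hgain
      rw [Nat.succ_div_of_dvd h, Finset.sum_range_succ]
      have hevolver : s (t + 1) = evolverStep (e (t / c)) (algorithmStep hT (s t)) := by
        rw [hs, if_pos h]
      rw [← hevolver] at hgain
      push_cast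
      omega
    · have hstep : s (t + 1) = algorithmStep hT (s t) := by rw [hs, if_neg h]
      rw [← hstep] at halg
      rw [Nat.succ_div_of_not_dvd h]
      omega

/-- Each of the `t' - t` steps of the algorithm shortens the overall distance or finishes a label,
and the at most half as many swaps lengthen it by at most `2` each. -/
lemma distance_add_sum_swapGain_le (hs : IsTrajectory hT c e s) (hc : 2 ≤ c) {t t' : ℕ}
    (htt' : t ≤ t') :
    ((s t').distance T : ℤ) + ∑ i ∈ Finset.Ico (t / c) (t' / c), swapGain c e s i +
        (s t).finished ≤
      (s t).distance T + (s t').finished + 1 := by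
  have ht := hs.distance_add_sum_swapGain t
  have ht' := hs.distance_add_sum_swapGain t'
  have hsum := Finset.sum_range_add_sum_Ico (swapGain c e s) (Nat.div_le_div_right (c := c) htt')
  have hdiv := two_mul_div_add_le hc htt'
  omega

lemma four_mul_card_repeatTimes_le (hs : IsTrajectory hT c e s) (hc : 0 < c) (a : ℕ) {m : ℕ}
    (hm : 0 < m) :
    4 * ((repeatTimes Meets a m e).card : ℤ) + 4 * (s (c * (a + 1))).finished ≤
      ∑ i ∈ Finset.Ico a (a + 2 * m), swapGain c e s i +
        4 * (s (c * (a + 2 * m))).finished + 4 := by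
  set f := (s (c * (a + 1))).finished
  set f' := (s (c * (a + 2 * m))).finished
  set touched : Finset (Fin n) := (Finset.Icc f f').image (Fin.ofNat n)
  have hcard : touched.card ≤ f' + 1 - f := Finset.card_image_le.trans_eq (Nat.card_Icc f f')
  have hff' : f ≤ f' := hs.finished_mono (Nat.mul_le_mul_left c (by omega))
  have hhyp (i : ℕ) (hi : i ∈ Finset.Ico a (a + 2 * m)) (l : Fin n) (hl : l ∉ touched) :
      (s (c * (i + 1))).hyp l = (s (c * (a + 1))).hyp l := by
    rw [Finset.mem_Ico] at hi
    refine hs.hyp_eq_of_current_ne (Nat.mul_le_mul_left c (by omega)) fun u hu hui => ?_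
    rintro rfl
    refine hl (Finset.mem_image_of_mem _ (Finset.mem_Icc.2 ⟨hs.finished_mono hu, ?_⟩))
    exact hs.finished_mono (hui.le.trans (Nat.mul_le_mul_left c (by omega)))
  have hrepeat : 4 * ((repeatTimes Meets a m e).card : ℤ) ≤
      ∑ i ∈ Finset.Ico a (a + 2 * m), swapGain c e s i + 4 * touched.card :=
    (hs.isSwapSequence hc).four_mul_card_repeatTimes_le hT.connected a m hhyp
  omega

/-- In each of `q` consecutive windows of choices, every swap that takes part in a repetition counts
as a gain, except for the few labels processed during the window. -/
lemma mul_le_sum_swapGain_add (hs : IsTrajectory hT c e s) (hc : 0 < c) {m ρ q t u : ℕ} (hm : 0 < m)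
    (hrepeat : ∀ q' < q, ρ < (repeatTimes Meets (t / c + q' * (2 * m)) m e).card)
    (htu : t ≤ u) (hu : c * (t / c + q * (2 * m)) ≤ u) :
    (q * (4 * ρ) : ℤ) + 4 * (s t).finished ≤
      ∑ i ∈ Finset.Ico (t / c) (t / c + q * (2 * m)), swapGain c e s i + 4 * (s u).finished := by
  induction q generalizing u with
  | zero => simpa using hs.finished_mono htu
  | succ q ih =>
    set a := t / c + q * (2 * m) with ha
    have hend : t / c + (q + 1) * (2 * m) = a + 2 * m := by rw [ha]; ring
    have hta : t ≤ c * (a + 1) :=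
      (Nat.lt_mul_div_succ t hc).le.trans (Nat.mul_le_mul_left c (by omega))
    specialize ih (fun q' hq' => hrepeat q' (by omega)) hta (Nat.mul_le_mul_left c (by omega))
    have hwindow := hs.four_mul_card_repeatTimes_le hc a hm
    have hcard := hrepeat q q.lt_succ_self
    rw [hend] at hu ⊢
    rw [← Finset.sum_Ico_consecutive _ (by omega : t / c ≤ a) (Nat.le_add_right a (2 * m))]
    have hmono := hs.finished_mono hu
    push_cast
    linarith

lemma labelDist_succ_le (hs : IsTrajectory hT c e s) (t : ℕ) (l : Fin n) :
    labelDist T (s (t + 1)) l ≤ labelDist T (algorithmStep hT (s t)) l +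
      ∑ i ∈ Finset.Ico (t / c) ((t + 1) / c),
        if (s (c * i)).truth l ∈ (e i).1 then 1 else 0 := by
  by_cases h : c ∣ t + 1
  · rw [hs, if_pos h, Nat.succ_div_of_dvd h, Nat.Ico_succ_singleton, Finset.sum_singleton,
      ← hs.truth_eq, ← truth_algorithmStep hT (s t)]
    exact labelDist_evolverStep_le hT.connected _ _ _
  · rw [hs, if_neg h]
    exact Nat.le_add_right _ _

lemma labelDist_le_add_sum (hs : IsTrajectory hT c e s) {t t' : ℕ} (htt' : t ≤ t') (l : Fin n) :
    labelDist T (s t') l ≤ labelDist T (s t) l +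
      ∑ i ∈ Finset.Ico (t / c) (t' / c), if (s (c * i)).truth l ∈ (e i).1 then 1 else 0 := by
  induction t', htt' using Nat.le_induction with
  | base => simp
  | succ t' htt' ih =>
    have hsucc := hs.labelDist_succ_le t' l
    have halg := labelDist_algorithmStep_le hT (s t') l
    rw [← Finset.sum_Ico_consecutive _ (Nat.div_le_div_right htt')
      (Nat.div_le_div_right (t'.le_add_right 1))]
    omega

lemma labelDist_current_add_le (hs : IsTrajectory hT c e s) {t u : ℕ}
    (h : (s (t + u)).finished = (s t).finished) :
    labelDist T (s (t + u)) (s t).current + u + t / c ≤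
      labelDist T (s t) (s t).current + (t + u) / c := by
  induction u with
  | zero => simp
  | succ u ih =>
    have hfin : (s (t + u)).finished = (s t).finished :=
      le_antisymm ((hs.finished_mono (by omega)).trans_eq h) (hs.finished_mono (by omega))
    have hcur : (s (t + u)).current = (s t).current := congrArg (Fin.ofNat n) hfin
    have halg := labelDist_algorithmStep_current hT (s (t + u))
    rw [← hs.finished_succ, add_assoc t u 1, h, hfin, hcur] at halg
    have hsucc := hs.labelDist_succ_le (t + u) (s t).current
    have hmono : (t + u) / c ≤ (t + u + 1) / c := Nat.div_le_div_right (Nat.le_succ _)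
    have hsum : (∑ i ∈ Finset.Ico ((t + u) / c) ((t + u + 1) / c),
        if (s (c * i)).truth (s t).current ∈ (e i).1 then 1 else 0) ≤
          (t + u + 1) / c - (t + u) / c := by
      rw [← Nat.card_Ico, Finset.sum_boole]
      exact Finset.card_filter_le _ _
    rw [add_assoc t u 1] at *
    have := ih hfin
    omega

lemma finished_lt (hs : IsTrajectory hT c e s) (hc : 2 ≤ c) (t : ℕ) :
    (s t).finished < (s (t + 2 * n)).finished := by
  refine (hs.finished_mono (by omega)).lt_of_ne fun h => ?_
  have hdist := hs.labelDist_current_add_le h.symm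
  have hlt := dist_lt_of_equiv hT.connected (s t).truth ((s t).truth (s t).current)
    ((s t).hyp (s t).current)
  have hdiv := two_mul_div_add_le hc (Nat.le_add_right t (2 * n))
  rw [labelDist, labelDist] at hdist
  omega

lemma finished_add_le (hs : IsTrajectory hT c e s) (hc : 2 ≤ c) (t x : ℕ) :
    (s t).finished + x ≤ (s (t + x * (2 * n))).finished := by
  induction x with
  | zero => simp
  | succ x ih =>
    have := hs.finished_lt hc (t + x * (2 * n))
    rw [add_mul, one_mul, ← add_assoc t]
    omega

lemma exists_finished_eq_lt (hs : IsTrajectory hT c e s) {t t' f : ℕ} (htt' : t ≤ t')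
    (ht : (s t).finished ≤ f) (ht' : f < (s t').finished) :
    ∃ u, t ≤ u ∧ u < t' ∧ (s u).finished = f ∧ f < (s (u + 1)).finished := by
  induction t', htt' using Nat.le_induction with
  | base => omega
  | succ t' htt' ih =>
    by_cases h : f < (s t').finished
    · obtain ⟨u, htu, hut', hu⟩ := ih h
      exact ⟨u, htu, by omega, hu⟩
    · have := hs.finished_succ_le t'
      exact ⟨t', htt', t'.lt_succ_self, by omega, ht'⟩

/-- Every label is at its true location at some time during the iteration, and from then on only the
swaps displace it. -/
lemma distance_add_two_mul_le (hs : IsTrajectory hT c e s) {t t' a : ℕ} (htt' : t ≤ t')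
    (ht : (s t).finished = n * a) (ht' : (s t').finished = n * (a + 1)) :
    (s t').distance T + 2 * (t / c) ≤ 2 * (t' / c) := by
  have hlabel (l : Fin n) : labelDist T (s t') l ≤
      ∑ i ∈ Finset.Ico (t / c) (t' / c), if (s (c * i)).truth l ∈ (e i).1 then 1 else 0 := by
    obtain ⟨u, htu, hut', hu, hu'⟩ := hs.exists_finished_eq_lt (f := n * a + l) htt' (by omega)
      (by rw [ht', mul_add]; omega)
    have hcur : (s u).current = l := by
      ext
      simp [State.current, hu, Nat.mod_eq_of_lt l.isLt]
    have hzero : labelDist T (s u) l = 0 :=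
      hcur ▸ labelDist_current_eq_zero (by rwa [← hs.finished_succ, hu])
    refine (hs.labelDist_le_add_sum hut'.le l).trans ?_
    rw [hzero, zero_add]
    gcongr
  have hdist : (s t').distance T ≤ (t' / c - t / c) * 2 :=
    calc (s t').distance T
        ≤ ∑ i ∈ Finset.Ico (t / c) (t' / c), ∑ l, if (s (c * i)).truth l ∈ (e i).1 then 1 else 0 :=
          (Finset.sum_le_sum fun l _ => hlabel l).trans_eq Finset.sum_comm
      _ ≤ ∑ _i ∈ Finset.Ico (t / c) (t' / c), 2 := by
          gcongr with i
          rw [Finset.sum_boole]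
          exact card_filter_mem_edge_le (e i) (s (c * i)).truth
      _ = (t' / c - t / c) * 2 := by simp
  have := Nat.div_le_div_right (c := c) htt'
  omega

lemma finished_eq_of_isLeast (hs : IsTrajectory hT c e s) (h0 : (s 0).finished = 0) {f t : ℕ}
    (h : IsLeast {u | f ≤ (s u).finished} t) : (s t).finished = f := by
  refine le_antisymm ?_ h.1
  obtain rfl | t := t
  · exact h0.trans_le (Nat.zero_le f)
  · have hlt : (s t).finished < f := not_le.1 fun hle => (h.2 hle).not_gt t.lt_succ_self
    exact (hs.finished_succ_le t).trans hlt

lemma startsIteration_succ_iff (hs : IsTrajectory hT c e s) (h0 : (s 0).finished = 0) {a t : ℕ} :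
    StartsIteration s (a + 1) t ↔ IsLeast {u | n * a ≤ (s u).finished} t := by
  have hiter (u : ℕ) : (s u).iteration = a + 1 ↔
      n * a ≤ (s u).finished ∧ (s u).finished < n * a + n := by
    rw [State.iteration, add_left_inj, Nat.div_eq_iff (NeZero.pos n), mul_comm a n]
    have := NeZero.pos n
    omega
  refine ⟨fun h => ?_, fun h => ?_⟩
  · have ht := (hiter t).1 h.1
    refine ⟨ht.1, fun u hu => le_of_not_gt fun hut => ?_⟩
    exact hut.not_ge (h.2 ((hiter u).2 ⟨hu, (hs.finished_mono hut.le).trans_lt ht.2⟩))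
  · have ht := hs.finished_eq_of_isLeast h0 h
    exact ⟨(hiter t).2 ⟨ht.ge, ht.trans_lt (Nat.lt_add_of_pos_right (NeZero.pos n))⟩,
      fun u hu => h.2 ((hiter u).1 hu).1⟩

lemma finished_eq (hs : IsTrajectory hT c e s) (h0 : (s 0).finished = 0) {a t : ℕ}
    (h : StartsIteration s (a + 1) t) : (s t).finished = n * a :=
  hs.finished_eq_of_isLeast h0 ((hs.startsIteration_succ_iff h0).1 h)

lemma exists_startsIteration_succ (hs : IsTrajectory hT c e s) (h0 : (s 0).finished = 0)
    (hc : 2 ≤ c) {a t : ℕ} (h : StartsIteration s (a + 1) t) :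
    ∃ t', t ≤ t' ∧ t' / c ≤ t / c + n * n ∧ StartsIteration s (a + 1 + 1) t' := by
  classical
  have ht := hs.finished_eq h0 h
  have hreach : n * (a + 1) ≤ (s (t + n * (2 * n))).finished := by
    simpa only [ht, mul_add, mul_one] using hs.finished_add_le hc t n
  have hex : ∃ u, n * (a + 1) ≤ (s u).finished := ⟨_, hreach⟩
  have hle : t ≤ Nat.find hex := by
    refine le_of_not_gt fun hlt => (NeZero.pos n).not_ge ?_
    have := (Nat.find_spec hex).trans (hs.finished_mono hlt.le)
    rw [ht, mul_add, mul_one] at this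
    omega
  refine ⟨Nat.find hex, hle, ?_, (hs.startsIteration_succ_iff h0).2
    ⟨Nat.find_spec hex, fun u hu => Nat.find_min' hex hu⟩⟩
  have hdiv := two_mul_div_add_le hc hle
  have hfind := Nat.find_min' hex hreach
  rw [mul_left_comm] at hfind
  omega

lemma exists_startsIteration (hs : IsTrajectory hT c e s) (h0 : (s 0).finished = 0) (hc : 2 ≤ c)
    (a : ℕ) : ∃ t, StartsIteration s (a + 1) t := by
  induction a with
  | zero => exact ⟨0, (hs.startsIteration_succ_iff h0).2 ⟨by simp, fun _ _ => Nat.zero_le _⟩⟩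
  | succ a ih =>
    obtain ⟨t, ht⟩ := ih
    obtain ⟨t', -, -, ht'⟩ := hs.exists_startsIteration_succ h0 hc ht
    exact ⟨t', ht'⟩

lemma distance_add_four_mul_le (hs : IsTrajectory hT c e s) (hc : 2 ≤ c) {m ρ q t t' a : ℕ}
    (hm : 0 < m) (htt' : t ≤ t') (ht : (s t).finished = n * a)
    (ht' : (s t').finished = n * (a + 1)) (hq : t / c + q * (2 * m) ≤ t' / c)
    (hrepeat : ∀ i, t / c ≤ i → i < t' / c → ρ < (repeatTimes Meets i m e).card) :
    (s t').distance T + 4 * ρ * q ≤ (s t).distance T + 5 * n + 1 := by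
  have hwindow (q' : ℕ) (hq' : q' < q) :
      ρ < (repeatTimes Meets (t / c + q' * (2 * m)) m e).card := by
    refine hrepeat _ (Nat.le_add_right _ _) (lt_of_lt_of_le ?_ hq)
    gcongr
  have hgain := hs.mul_le_sum_swapGain_add (by omega) hm hwindow htt'
    ((Nat.mul_le_mul_left c hq).trans (Nat.mul_div_le t' c))
  have hdist := hs.distance_add_sum_swapGain_le hc htt'
  have hsum : ∑ i ∈ Finset.Ico (t / c) (t / c + q * (2 * m)), swapGain c e s i ≤
      ∑ i ∈ Finset.Ico (t / c) (t' / c), swapGain c e s i :=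
    Finset.sum_le_sum_of_subset_of_nonneg (Finset.Ico_subset_Ico le_rfl hq) fun i _ _ =>
      swapGain_nonneg hT.connected c e s i
  rw [ht, ht'] at hgain hdist
  push_cast at hgain hdist
  zify
  linarith

/-- The distance at the end of an iteration is at most twice the number of its swaps, a fixed
proportion of which are lost to repetitions, so that the gain is proportional to the distance. -/
lemma distance_mul_le (hs : IsTrajectory hT c e s) (hc : 2 ≤ c) {m ρ L t t' a : ℕ} (hm : 0 < m)
    (hmL : m ≤ L * ρ) (hρ : ρ ≤ n) (htt' : t ≤ t') (ht : (s t).finished = n * a)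
    (ht' : (s t').finished = n * (a + 1))
    (hrepeat : ∀ i, t / c ≤ i → i < t' / c → ρ < (repeatTimes Meets i m e).card) :
    ((s t').distance T : ℝ) * (1 + 1 / L) ≤ (s t).distance T + 10 * n := by
  have hmono := Nat.div_le_div_right (c := c) htt'
  set q := (t' / c - t / c) / (2 * m)
  have hq : q * (2 * m) ≤ t' / c - t / c := Nat.div_mul_le_self _ _
  have hq' : t' / c - t / c ≤ 2 * m * (q + 1) := (Nat.lt_mul_div_succ _ (by omega)).le
  have hgain := hs.distance_add_four_mul_le hc hm htt' ht ht' (q := q) (by omega) hrepeat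
  have hdisplaced : (s t').distance T ≤ 4 * ρ * (q + 1) * L :=
    calc (s t').distance T ≤ 2 * (2 * m * (q + 1)) := by
          have := hs.distance_add_two_mul_le htt' ht ht'
          omega
      _ ≤ 2 * (2 * (L * ρ) * (q + 1)) := by gcongr
      _ = 4 * ρ * (q + 1) * L := by ring
  have hn : (1 : ℝ) ≤ n := Nat.one_le_cast.2 (NeZero.pos n)
  have hρ' : (ρ : ℝ) ≤ n := Nat.cast_le.2 hρ
  have hdiv : ((s t').distance T : ℝ) / L ≤ 4 * ρ * (q + 1) :=
    div_le_of_le_mul₀ (by positivity) (by positivity) (by exact_mod_cast hdisplaced)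
  have hgain' : ((s t').distance T : ℝ) + 4 * ρ * q ≤ (s t).distance T + 5 * n + 1 := by
    exact_mod_cast hgain
  rw [mul_add, mul_one, mul_one_div]
  linarith

lemma exists_startsIteration_distance_le (hs : IsTrajectory hT c e s)
    (h0 : (s 0).finished = 0) (hc : 2 ≤ c) {m ρ L t a : ℕ} (hm : 0 < m) (hmL : m ≤ L * ρ)
    (hρ : ρ ≤ n) (ht : StartsIteration s (a + 1) t) (z : ℕ)
    (hrepeat : ∀ q < z * (n * n), ρ < (repeatTimes Meets (t / c + q) m e).card) :
    ∃ t', t' / c ≤ t / c + z * (n * n) ∧ t ≤ t' ∧ StartsIteration s (a + z + 1) t' ∧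
      ((s t').distance T : ℝ) ≤ n * n / (1 + 1 / L) ^ z + 10 * L * n := by
  have hL : (0 : ℝ) < L := Nat.cast_pos.2 (Nat.pos_of_mul_pos_right (hm.trans_le hmL))
  induction z with
  | zero =>
    refine ⟨t, by simp, le_rfl, ht, ?_⟩
    have hsq : ((s t).distance T : ℝ) ≤ n * n :=
      mod_cast distance_le_mul_self hT.connected (s t)
    rw [pow_zero, div_one]
    exact hsq.trans (le_add_of_nonneg_right (by positivity))
  | succ z ih =>
    rw [add_mul, one_mul] at hrepeat ⊢
    obtain ⟨t', htt'c, htt', ht', hdist⟩ := ih fun q hq => hrepeat q (by omega)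
    obtain ⟨t'', ht't'', hdiv, ht''⟩ := hs.exists_startsIteration_succ h0 hc ht'
    refine ⟨t'', by omega, htt'.trans ht't'', ht'', ?_⟩
    have hcontract := hs.distance_mul_le hc hm hmL hρ ht't'' (hs.finished_eq h0 ht')
      (hs.finished_eq h0 ht'') fun i hi hi' => by
        have hmono := Nat.div_le_div_right (c := c) htt'
        simpa [Nat.add_sub_cancel' (hmono.trans hi)] using hrepeat (i - t / c) (by omega)
    have hpos : (0 : ℝ) < 1 + 1 / L := by positivity
    refine le_of_mul_le_mul_right (hcontract.trans ?_) hpos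
    calc ((s t').distance T : ℝ) + 10 * n
        ≤ n * n / (1 + 1 / L) ^ z + 10 * L * n + 10 * n := by gcongr
      _ = (n * n / (1 + 1 / L) ^ (z + 1) + 10 * L * n) * (1 + 1 / L) := by
          rw [add_mul, pow_succ, ← div_div, div_mul_cancel₀ _ hpos.ne']
          field_simp
          ring

end IsTrajectory

end Trajectory

section Locality

variable {V : Type*} [DecidableEq V] {T : SimpleGraph V} {n : ℕ} [NeZero n]

lemma run_congr (hT : T.IsTree) {c : ℕ} (M₀ : Fin n ≃ V) (H₀ : Fin n → V)
    {e e' : ℕ → T.edgeSet} {t : ℕ} (h : ∀ i < t / c, e i = e' i) :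
    run hT c M₀ H₀ e t = run hT c M₀ H₀ e' t := by
  induction t with
  | zero => rfl
  | succ t ih =>
    rw [run, run, ih fun i hi => h i (hi.trans_le (Nat.div_le_div_right t.le_succ))]
    split_ifs with hdvd
    · rw [h (t / c) (by rw [Nat.succ_div_of_dvd hdvd]; omega)]
    · rfl

lemma dependsOn_startsIteration (hT : T.IsTree) {c : ℕ} (M₀ : Fin n ≃ V)
    (H₀ : Fin n → V) (a t : ℕ) :
    DependsOn (fun e => StartsIteration (run hT c M₀ H₀ e) (a + 1) t) (Finset.range (t / c)) := by
  suffices h : ∀ e e', (∀ i ∈ Finset.range (t / c), e i = e' i) →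
      StartsIteration (run hT c M₀ H₀ e) (a + 1) t → StartsIteration (run hT c M₀ H₀ e') (a + 1) t
    from fun e e' he => propext ⟨h e e' he, h e' e fun i hi => (he i hi).symm⟩
  intro e e' he
  have hrun (u : ℕ) (hu : u ≤ t) : run hT c M₀ H₀ e u = run hT c M₀ H₀ e' u :=
    run_congr hT M₀ H₀ fun i hi =>
      he i (Finset.mem_range.2 (hi.trans_le (Nat.div_le_div_right hu)))
  rw [(isTrajectory_run hT c M₀ H₀ e).startsIteration_succ_iff rfl,
    (isTrajectory_run hT c M₀ H₀ e').startsIteration_succ_iff rfl]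
  refine fun h => ⟨?_, fun u hu => le_of_not_gt fun hut => hut.not_ge (h.2 ?_)⟩
  · simpa only [Set.mem_ofPred_eq, hrun t le_rfl] using h.1
  · simpa only [Set.mem_ofPred_eq, hrun u hut.le] using hu

end Locality

section Probability

variable {Ω : Type*} [MeasurableSpace Ω] {μ : Measure Ω}

lemma measure_iUnion_inter_le [IsZeroOrProbabilityMeasure μ] {ι : Type*} [Countable ι]
    {A B : ι → Set Ω} {ε : ℝ≥0∞} (hA : ∀ t, MeasurableSet (A t))
    (hdisj : Pairwise (Function.onFun Disjoint A)) (hind : ∀ t, IndepSet (A t) (B t) μ)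
    (hB : ∀ t, μ (B t) ≤ ε) : μ (⋃ t, A t ∩ B t) ≤ ε :=
  calc μ (⋃ t, A t ∩ B t) ≤ ∑' t, μ (A t ∩ B t) := measure_iUnion_le _
    _ ≤ ∑' t, μ (A t) * ε := ENNReal.tsum_le_tsum fun t => by
        rw [(hind t).measure_inter_eq_mul]
        gcongr
        exact hB t
    _ = μ (⋃ t, A t) * ε := by rw [ENNReal.tsum_mul_right, measure_iUnion hdisj hA]
    _ ≤ ε := mul_le_of_le_one_left' prob_le_one

lemma measureReal_exists_lt_le {P : ℕ → Ω → Prop} {δ : ℝ} (hδ : ∀ q, μ.real {ω | P q ω} ≤ δ)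
    (Q : ℕ) : μ.real {ω | ∃ q < Q, P q ω} ≤ Q * δ :=
  calc μ.real {ω | ∃ q < Q, P q ω} = μ.real (⋃ q ∈ Finset.range Q, {ω | P q ω}) := by
        congr 1
        ext
        simp only [Finset.mem_range, Set.mem_iUnion, Set.mem_ofPred_eq, exists_prop]
    _ ≤ ∑ q ∈ Finset.range Q, μ.real {ω | P q ω} := measureReal_biUnion_finset_le _ _
    _ ≤ Q * δ := by simpa using Finset.sum_le_card_nsmul (Finset.range Q) _ δ fun q _ => hδ q

lemma one_sub_le_measureReal_of_forall_notMem [IsProbabilityMeasure μ] {A B : Set Ω} {ε : ℝ}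
    (hB : μ.real B ≤ ε) (h : ∀ ω ∉ B, ω ∈ A) : 1 - ε ≤ μ.real A := by
  have hunion : μ.real Set.univ ≤ μ.real B + μ.real A :=
    (measureReal_mono fun ω _ => or_iff_not_imp_left.2 (h ω)).trans (measureReal_union_le B A)
  rw [probReal_univ] at hunion
  linarith

lemma IsUniformEvolver.isIIDUniform {V : Type*} {T : SimpleGraph V} [Fintype T.edgeSet]
    [MeasurableSpace T.edgeSet] {E : ℕ → Ω → T.edgeSet} (hE : IsUniformEvolver μ E) :
    IsIIDUniform μ E where
  measurable i := measurable_to_countable' (hE.measurable i)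
  indep := hE.indep.comp (fun _ => id) fun _ => measurable_from_top
  uniform i x := by
    rw [measureReal_def, hE.uniform, Nat.card_eq_fintype_card, ENNReal.toReal_inv,
      ENNReal.toReal_natCast]

variable [IsProbabilityMeasure μ] {V : Type*} [Fintype V] [DecidableEq V] {T : SimpleGraph V}
  [DecidableRel T.Adj] [MeasurableSpace T.edgeSet] [DiscreteMeasurableSpace T.edgeSet]
  {E : ℕ → Ω → T.edgeSet} {n : ℕ} [NeZero n]

/-- The choices made after the start of an iteration are independent of when it starts. -/
lemma measureReal_startsIteration_card_repeatTimes_le_le (hE : IsIIDUniform μ E)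
    (hT : T.IsTree) (c : ℕ) (M₀ : Fin n ≃ V) (H₀ : Fin n → V) {m ρ : ℕ} {δ : ℝ}
    (hδ : ∀ i, μ.real {ω | (repeatTimes Meets i m (E · ω)).card ≤ ρ} ≤ δ) (a Q : ℕ) :
    μ.real {ω | ∃ t, StartsIteration (run hT c M₀ H₀ (E · ω)) (a + 1) t ∧
      ∃ q < Q, (repeatTimes Meets (t / c + q) m (E · ω)).card ≤ ρ} ≤ Q * δ := by
  have hδ0 : 0 ≤ δ := measureReal_nonneg.trans (hδ 0)
  have hfewDependsOn (i : ℕ) :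
      DependsOn (fun f => ∃ q < Q, (repeatTimes (Meets (T := T)) (i + q) m f).card ≤ ρ)
        (Finset.Ico i (i + Q + 2 * m)) := by
    intro f f' hff'
    refine propext (exists_congr fun q => and_congr_right fun hq => ?_)
    rw [dependsOn_repeatTimes (R := Meets) (i + q) m fun x hx => hff' x ?_]
    simp only [Finset.coe_Ico, Set.mem_Ico] at hx ⊢
    omega
  have hdisj (t : ℕ) : Disjoint (Finset.range (t / c))
      (Finset.Ico (t / c) (t / c + Q + 2 * m)) := by
    rw [Finset.range_eq_Ico]
    exact Finset.Ico_disjoint_Ico_consecutive _ _ _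
  have hmain := measure_iUnion_inter_le (μ := μ) (ε := ENNReal.ofReal (Q * δ))
    (fun t => measurableSet_setOfPred.2 <|
      measurable_comp_of_dependsOn hE.measurable (dependsOn_startsIteration hT M₀ H₀ a t))
    (fun t t' htt' => Set.disjoint_left.2 fun ω h h' => htt' (IsLeast.unique h h'))
    (fun t => indepSet_of_dependsOn hE.measurable hE.indep (hdisj t)
      (dependsOn_startsIteration hT M₀ H₀ a t) (hfewDependsOn (t / c)))
    (fun t => (ENNReal.le_ofReal_iff_toReal_le (measure_ne_top _ _) (by positivity)).2
      (measureReal_exists_lt_le (fun q => hδ (t / c + q)) Q))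
  refine ENNReal.toReal_le_of_le_ofReal (by positivity) ((measure_mono ?_).trans hmain)
  exact fun ω ⟨t, ht⟩ => Set.mem_iUnion.2 ⟨t, ht⟩

lemma le_measureReal_exists_startsIteration_distance_le (hE : IsIIDUniform μ E) (hT : T.IsTree)
    {c : ℕ} (hc : 2 ≤ c) (M₀ : Fin n ≃ V) (H₀ : Fin n → V) {m ρ L : ℕ} {δ : ℝ} (hm : 0 < m)
    (hmL : m ≤ L * ρ) (hρ : ρ ≤ n)
    (hδ : ∀ i, μ.real {ω | (repeatTimes Meets i m (E · ω)).card ≤ ρ} ≤ δ) (a z : ℕ) :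
    1 - z * (n * n) * δ ≤ μ.real {ω | ∃ t,
      StartsIteration (run hT c M₀ H₀ (E · ω)) (a + z + 1) t ∧
      ((run hT c M₀ H₀ (E · ω) t).distance T : ℝ) ≤ n * n / (1 + 1 / L) ^ z + 10 * L * n} := by
  have hbad := measureReal_startsIteration_card_repeatTimes_le_le hE hT c M₀ H₀ hδ a (z * (n * n))
  push_cast at hbad
  refine one_sub_le_measureReal_of_forall_notMem hbad fun ω hω => ?_
  have hs := isTrajectory_run hT c M₀ H₀ (E · ω)
  obtain ⟨t, ht⟩ := hs.exists_startsIteration rfl (by omega) a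
  obtain ⟨t', -, -, ht', hdist⟩ := hs.exists_startsIteration_distance_le rfl hc hm hmL hρ ht z
    fun q hq => not_le.1 fun hle => hω ⟨t, ht, q, hq, hle⟩
  exact ⟨t', ht', hdist⟩

end Probability

section Numerics

lemma isBigO_ceil_log_div (b : ℝ) :
    (fun n : ℕ => (⌈Real.log n / b⌉₊ : ℝ)) =O[atTop] fun n : ℕ => Real.log n := by
  have hlog : Tendsto (fun n : ℕ => Real.log n) atTop atTop :=
    Real.tendsto_log_atTop.comp tendsto_natCast_atTop_atTop
  refine IsBigO.of_bound (|b⁻¹| + 1) ?_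
  filter_upwards [hlog.eventually_ge_atTop 1] with n hn
  rw [Real.norm_of_nonneg (by positivity), Real.norm_of_nonneg (by linarith)]
  calc (⌈Real.log n / b⌉₊ : ℝ) ≤ ⌈|b⁻¹| * Real.log n⌉₊ := by
        rw [div_eq_inv_mul]
        gcongr
        exact le_abs_self _
    _ ≤ |b⁻¹| * Real.log n + 1 := (Nat.ceil_lt_add_one (by positivity)).le
    _ ≤ (|b⁻¹| + 1) * Real.log n := by linarith

lemma eventually_ceil_log_div_mul_exp_le {b γ γ' : ℝ} (hb : 0 < b) (hγ : γ' < γ) :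
    ∀ᶠ n : ℕ in atTop, ⌈Real.log n / b⌉₊ * (n * n) * (2 * Real.exp (-(γ * n))) ≤
      Real.exp (-γ' * n) := by
  have hcube := (isLittleO_pow_exp_pos_mul_atTop 3 (sub_pos.2 hγ)).comp_tendsto
    (tendsto_natCast_atTop_atTop (R := ℝ))
  have hconst : (0 : ℝ) < 2 * (1 / b + 1) := by positivity
  filter_upwards [hcube.bound (inv_pos.2 hconst), eventually_ge_atTop 1] with n hn hn1
  have hn1 : (1 : ℝ) ≤ n := Nat.one_le_cast.2 hn1
  simp only [Function.comp_apply, norm_pow, RCLike.norm_natCast, Real.norm_eq_abs,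
    Real.abs_exp] at hn
  rw [← div_eq_inv_mul, le_div_iff₀ hconst] at hn
  have : 0 ≤ Real.log n := Real.log_nonneg hn1
  calc (⌈Real.log n / b⌉₊ : ℝ) * (n * n) * (2 * Real.exp (-(γ * n)))
      ≤ (Real.log n / b + 1) * (n * n) * (2 * Real.exp (-(γ * n))) := by
        gcongr
        exact (Nat.ceil_lt_add_one (by positivity)).le
    _ ≤ (n / b + n) * (n * n) * (2 * Real.exp (-(γ * n))) := by
        gcongr
        exact Real.log_le_self (by positivity)
    _ = (n : ℝ) ^ 3 * (2 * (1 / b + 1)) * Real.exp (-(γ * n)) := by ring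
    _ ≤ Real.exp ((γ - γ') * n) * Real.exp (-(γ * n)) := by gcongr
    _ = Real.exp (-γ' * n) := by
        rw [← Real.exp_add]
        ring_nf

lemma mul_self_div_pow_ceil_log_le {x y : ℝ} (hx : 1 < x) (hy : 0 < y) :
    y * y / x ^ ⌈Real.log y / Real.log x⌉₊ ≤ y := by
  rw [div_le_iff₀ (by positivity)]
  gcongr
  rw [← Real.log_le_log_iff hy (by positivity), Real.log_pow, ← div_le_iff₀ (Real.log_pos hx)]
  exact Nat.le_ceil _

lemma exists_window_parameters {κ : ℕ} (hκ : 0 < κ) :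
    ∃ (L N : ℕ) (γ : ℝ), 0 < L ∧ 0 < γ ∧ ∀ n > N, ∃ s ρ : ℕ,
      0 < s ∧ 2 * κ * s ≤ L * ρ ∧ ρ ≤ n ∧ γ * n ≤ ρ ∧ 32 * κ ^ 3 * s ≤ n - 1 ∧
      2 * ρ * (n - 1) ≤ κ ^ 2 * s ^ 2 := by
  obtain ⟨K, hK⟩ : ∃ K, K = 2 ^ 12 * κ ^ 4 := ⟨_, rfl⟩
  have hK0 : 0 < K := by rw [hK]; positivity
  refine ⟨2 ^ 8 * κ ^ 2, K, 1 / (4 * K), by positivity, by positivity, fun n hn => ?_⟩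
  obtain ⟨N, rfl⟩ : ∃ N, n = N + 1 := Nat.exists_eq_add_one.2 (by omega)
  obtain ⟨ρ, hρ⟩ : ∃ ρ, ρ = N / K := ⟨_, rfl⟩
  have hρ0 : 0 < ρ := hρ ▸ Nat.div_pos (by omega) hK0
  have hlower : K * ρ ≤ N := hρ ▸ Nat.mul_div_le N K
  have hupper : N ≤ 2 * K * ρ := by
    have hlt := hρ ▸ Nat.lt_mul_div_succ N hK0
    have hle := Nat.le_mul_of_pos_right K hρ0
    linarith
  refine ⟨2 ^ 7 * κ * ρ, ρ, by positivity, by linarith, ?_, ?_, ?_, ?_⟩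
  · exact hρ ▸ (Nat.div_le_self N K).trans N.le_succ
  · have : ((N + 1 : ℕ) : ℝ) ≤ 4 * K * ρ := by
      exact_mod_cast (by linarith : N + 1 ≤ 4 * K * ρ)
    rw [one_div_mul_eq_div, div_le_iff₀ (by positivity)]
    linarith
  · calc 32 * κ ^ 3 * (2 ^ 7 * κ * ρ) = K * ρ := by rw [hK]; ring
      _ ≤ N := hlower
  · calc 2 * ρ * N ≤ 2 * ρ * (2 * K * ρ) := by gcongr
      _ = κ ^ 2 * (2 ^ 7 * κ * ρ) ^ 2 := by rw [hK]; ring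

end Numerics

section Decay

variable {Ω : Type*} [MeasurableSpace Ω] {μ : Measure Ω} [IsProbabilityMeasure μ] {V : Type*}
  [DecidableEq V] {T : SimpleGraph V} {n : ℕ} [NeZero n]

lemma measureReal_distance_le_mul_self (hT : T.IsTree) {c : ℕ} (hc : 2 ≤ c) (M₀ : Fin n ≃ V)
    (H₀ : Fin n → V) (E : ℕ → Ω → T.edgeSet) (a : ℕ) :
    μ.real {ω | ∃ t, StartsIteration (run hT c M₀ H₀ (E · ω)) (a + 1) t ∧
      ((run hT c M₀ H₀ (E · ω) t).distance T : ℝ) ≤ n * n} = 1 := by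
  convert probReal_univ (μ := μ)
  refine Set.eq_univ_of_forall fun ω => ?_
  obtain ⟨t, ht⟩ := (isTrajectory_run hT c M₀ H₀ (E · ω)).exists_startsIteration rfl hc a
  exact ⟨t, ht, mod_cast distance_le_mul_self hT.connected _⟩

variable [Fintype V] [DecidableRel T.Adj] {E : ℕ → Ω → T.edgeSet}

lemma one_sub_le_measureReal_distance_le_add (hE : IsUniformEvolver μ E) (hT : T.IsTree) {c : ℕ}
    (hc : 2 ≤ c) (M₀ : Fin n ≃ V) (H₀ : Fin n → V) {κ s ρ L : ℕ} {γ : ℝ}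
    (hdeg : 2 * T.maxDegree ≤ κ) (hκ : 0 < κ) (hs : 0 < s) (hsL : 2 * κ * s ≤ L * ρ) (hρ : ρ ≤ n)
    (hγ : γ * n ≤ ρ) (hsn : 32 * κ ^ 3 * s ≤ n - 1)
    (hρs : 2 * ρ * (n - 1) ≤ κ ^ 2 * s ^ 2) (a z : ℕ) :
    1 - z * (n * n) * (2 * Real.exp (-(γ * n))) ≤ μ.real {ω | ∃ t,
      StartsIteration (run hT c M₀ H₀ (E · ω)) (a + z + 1) t ∧
      ((run hT c M₀ H₀ (E · ω) t).distance T : ℝ) ≤ n * n / (1 + 1 / L) ^ z + 10 * L * n} := by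
  let _ : MeasurableSpace T.edgeSet := ⊤
  have : DiscreteMeasurableSpace T.edgeSet := ⟨fun _ => trivial⟩
  have hcard : Fintype.card T.edgeSet = n - 1 := by
    have h := hT.card_edgeFinset
    rw [SimpleGraph.edgeFinset_card, Fintype.card_congr M₀.symm, Fintype.card_fin] at h
    omega
  rw [← hcard] at hsn hρs
  have hwindow (i : ℕ) : μ.real {ω | (repeatTimes Meets i (2 * κ * s) (E · ω)).card ≤ ρ} ≤
      2 * Real.exp (-(γ * n)) :=
    (hE.isIIDUniform.measureReal_card_repeatTimes_le_le Meets.refl (fun _ _ h => h.symm)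
      (fun x => (card_filter_meets_le x).trans hdeg) i hsn hρs).trans (by gcongr)
  exact le_measureReal_exists_startsIteration_distance_le hE.isIIDUniform hT hc M₀ H₀
    (by positivity) hsL hρ hwindow a z

end Decay

end LabelTracking

theorem mainTheorem2_general (k : ℕ) :
    ∃ (z : ℕ → ℕ) (C γ : ℝ), 0 < C ∧ 0 < γ ∧
      (fun n : ℕ => (z n : ℝ)) =O[atTop] (fun n : ℕ => Real.log n) ∧
      ∀ (c : ℕ) (_ : 2 ≤ c) (n : ℕ) [NeZero n] (V : Type*) [Fintype V] [DecidableEq V]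
        (T : SimpleGraph V) [DecidableRel T.Adj] (hT : T.IsTree) (_ : T.maxDegree ≤ k)
        (M₀ : Fin n ≃ V) (H₀ : Fin n → V)
        (Ω : Type*) [MeasurableSpace Ω] (μ : Measure Ω) [IsProbabilityMeasure μ]
        (E : ℕ → Ω → T.edgeSet) (_ : LabelTracking.IsUniformEvolver μ E)
        (j : ℕ) (_ : z n < j),
        1 - Real.exp (-γ * n) ≤
          μ.real {ω | ∃ t,
            LabelTracking.StartsIteration
              (LabelTracking.run hT c M₀ H₀ (fun i => E i ω)) j t ∧
            ((LabelTracking.run hT c M₀ H₀ (fun i => E i ω) t).distance T : ℝ) ≤ C * n} := by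
  obtain ⟨L, N, γ, hL, hγ, hparameters⟩ :=
    LabelTracking.exists_window_parameters (Nat.succ_pos (2 * k))
  have hx : (1 : ℝ) < 1 + 1 / L := lt_add_of_pos_right 1 (by positivity)
  obtain ⟨n₀, hn₀⟩ := eventually_atTop.1 ((eventually_gt_atTop N).and
    (LabelTracking.eventually_ceil_log_div_mul_exp_le (Real.log_pos hx) (half_lt_self hγ)))
  refine ⟨fun n => ⌈Real.log n / Real.log (1 + 1 / L)⌉₊, n₀ + (1 + 10 * L), γ / 2,
    by positivity, half_pos hγ, LabelTracking.isBigO_ceil_log_div _, ?_⟩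
  intro c hc n _ V _ _ T _ hT hk M₀ H₀ Ω _ μ _ E hE j hj
  obtain ⟨a, rfl⟩ := Nat.exists_eq_add_of_lt hj
  rw [add_comm _ a]
  rcases lt_or_ge n n₀ with hsmall | hlarge
  · refine (sub_le_self 1 (Real.exp_pos _).le).trans <|
      (LabelTracking.measureReal_distance_le_mul_self hT hc M₀ H₀ E _).ge.trans <|
      measureReal_mono fun ω ⟨t, ht, hdist⟩ => ⟨t, ht, hdist.trans ?_⟩
    have hsmall : (n : ℝ) ≤ n₀ := Nat.cast_le.2 hsmall.le
    gcongr
    exact hsmall.trans (le_add_of_nonneg_right (by positivity))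
  · obtain ⟨hN, hexp⟩ := hn₀ n hlarge
    obtain ⟨s, ρ, hs, hsL, hρ, hγρ, hsn, hρs⟩ := hparameters n hN
    refine (sub_le_sub_left hexp 1).trans <|
      (LabelTracking.one_sub_le_measureReal_distance_le_add hE hT hc M₀ H₀ (by omega)
        (Nat.succ_pos _) hs hsL hρ hγρ hsn hρs a _).trans <|
      measureReal_mono fun ω ⟨t, ht, hdist⟩ => ⟨t, ht, hdist.trans ?_⟩
    have hdecay := LabelTracking.mul_self_div_pow_ceil_log_le hx
      (Nat.cast_pos.2 (NeZero.pos n) : (0 : ℝ) < n)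
    have hn₀n : (0 : ℝ) ≤ n₀ * n := by positivity
    linarith

theorem mainTheorem2 (k : ℕ) :
    ∃ (z : ℕ → ℕ) (C γ : ℝ), 0 < C ∧ 0 < γ ∧
      (fun n : ℕ => (z n : ℝ)) =O[atTop] (fun n : ℕ => Real.log n) ∧
      ∀ (n : ℕ) [NeZero n] (V : Type*) [Fintype V] [DecidableEq V]
        (T : SimpleGraph V) [DecidableRel T.Adj] (hT : T.IsTree) (_ : T.maxDegree ≤ k)
        (M₀ : Fin n ≃ V) (H₀ : Fin n → V)
        (Ω : Type*) [MeasurableSpace Ω] (μ : Measure Ω) [IsProbabilityMeasure μ]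
        (E : ℕ → Ω → T.edgeSet) (_ : LabelTracking.IsUniformEvolver μ E)
        (j : ℕ) (_ : z n < j),
        1 - Real.exp (-γ * n) ≤
          μ.real {ω | ∃ t,
            LabelTracking.StartsIteration
              (LabelTracking.run hT 2 M₀ H₀ (fun i => E i ω)) j t ∧
            ((LabelTracking.run hT 2 M₀ H₀ (fun i => E i ω) t).distance T : ℝ) ≤ C * n} := by
  obtain ⟨z, C, γ, hC, hγ, hz, h⟩ := mainTheorem2_general k
  exact ⟨z, C, γ, hC, hγ, hz, h 2 le_rfl⟩
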